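/- **Local convergence with exact eigenvectors.** Let $f:\mathbb{R}^d\to\mathbb{R}$ and $c_1,\dots,c_m:\mathbb{R}^d\to\mathbb{R}$ be smooth ($C^\infty$), and let $\mathcal M=\{x\in\mathbb{R}^d: c_1(x)=\dots=c_m(x)=0\}$, where $\nabla c_1(x),\dots,\nabla c_m(x)$ are linearly independent for every $x\in\mathcal M$. For $x\in\mathcal M$ let $T_x\mathcal M=\operatorname{span}\{\nabla c_i(x)\}^{\perp}$, let $P(x)$ be the orthogonal projection onto $T_x\mathcal M$, and let $\operatorname{grad} f(x)=P(x)\nabla f(x)$ and $\operatorname{Hess} f(x)[v]=P(x)\,\partial_v \operatorname{grad} f(x)$ ($v\in T_x\mathcal M$) be the Riemannian gradient and Hessian. Let $d(\cdot,\cdot)$ be the geodesic distance on $\mathcal M$. Let $\mathrm{Ret}$ be a retraction, i.e. a family of maps $\mathrm{Ret}_x:T_x\mathcal M\to\mathcal M$, jointly smooth on the tangent bundle, with $\mathrm{Ret}_x(0)=x$ and $\frac{d}{dt}\big|_{t=0}\mathrm{Ret}_x(tv)=v$ for all $v\in T_x\mathcal M$. Let $x^*\in\mathcal M$ be an index-$k$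 saddle point of $f$ on $\mathcal M$: $\operatorname{grad} f(x^*)=0$, and $\operatorname{Hess} f(x^*)$ has exactly $k\le d-m-1$ negative eigenvalues, counted with multiplicity. Assume (strict saddle) that $\delta>0$ and $L>\mu>0$ are such that for every $x\in U_\delta=\{x\in\mathcal M: d(x,x^*)<\delta\}$ the eigenvalues of $\operatorname{Hess} f(x)$ satisfy $$-L\le\lambda_1\le\dots\le\lambda_k\le-\mu<0<\mu\le\lambda_{k+1}\le\dots\le\lambda_{d-m}\le L .$$ Put $\kappa=L/\mu$. Then there is a neighborhood $U$ of $x^*$ in $\mathcal M$ such that for every step size $0<\Delta t\le 1/L$ and every $x_0\in U$ the following holds. Let $(x_n)_{n\ge0}$ be any sequence generated by the discrete constrained saddle dynamics $$x_{n+1}=\mathrm{Ret}_{x_n}\Big(-\Delta t\Big(I-2\sum_{i=1}^k v_n^i (v_n^i)^{\top}\Big)\operatorname{grad} f(x_n)\Big),\qquad n\ge 0,$$ where, for each $n$, $v_n^1,\dots,v_n^k\in T_{x_n}\mathcal M$ are orthonormal eigenvectors of $\operatorname{Hess} f(x_n)$ associated with its $k$ smallest eigenvalues (counted with multiplicity).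 Then $x_n\in U_\delta$ for all $n$, $x_n\to x^*$, and the convergence is linear with rate $1-\frac{\Delta t\,\mu}{2}$: $$d(x_{n+1},x^*)\le\Big(1-\frac{\Delta t\,\mu}{2}\Big)\,d(x_n,x^*)\qquad\text{for all } n\ge0 .$$ The rate satisfies $1-\frac{1}{2\kappa}\le 1-\frac{\Delta t\,\mu}{2}<1$, and it equals $1-\frac1{2\kappa}$ for $\Delta t=1/L$. -/

import Mathlib

open scoped ContDiff Topology ENNReal Gradient RealInnerProductSpace
open Set Filter MeasureTheory

noncomputable section

namespace CSD

/-- The feasible set `M = {x | c₁(x) = ⋯ = c_m(x) = 0}`. -/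
def feasibleSet {d m : ℕ} (c : Fin m → EuclideanSpace ℝ (Fin d) → ℝ) :
    Set (EuclideanSpace ℝ (Fin d)) :=
  {x | ∀ i, c i x = 0}

/-- LICQ: at every feasible point the constraint gradients are linearly independent. -/
def LICQ {d m : ℕ} (c : Fin m → EuclideanSpace ℝ (Fin d) → ℝ) : Prop :=
  ∀ x ∈ feasibleSet c, LinearIndependent ℝ (fun i => ∇ (c i) x)

/-- The normal space, spanned by the constraint gradients. -/
def normalSpace {d m : ℕ} (c : Fin m → EuclideanSpace ℝ (Fin d) → ℝ)
    (x : EuclideanSpace ℝ (Fin d)) : Submodule ℝ (EuclideanSpace ℝ (Fin d)) :=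
  Submodule.span ℝ (range fun i => ∇ (c i) x)

/-- The tangent space `T_x M = (N_x M)ᗮ`, with the inner product of `ℝ^d`.
The formula makes sense at every `x`; it is used off `M` only in order to
differentiate the Riemannian gradient at points of `M`. -/
def tangentSpace {d m : ℕ} (c : Fin m → EuclideanSpace ℝ (Fin d) → ℝ)
    (x : EuclideanSpace ℝ (Fin d)) : Submodule ℝ (EuclideanSpace ℝ (Fin d)) :=
  (normalSpace c x)ᗮ

/-- The Riemannian gradient: the orthogonal projection of `∇ f(x)` onto `T_x M`. -/
def riemGrad {d m : ℕ} (c : Fin m → EuclideanSpace ℝ (Fin d) → ℝ)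
    (f : EuclideanSpace ℝ (Fin d) → ℝ) (x : EuclideanSpace ℝ (Fin d)) : tangentSpace c x :=
  (tangentSpace c x).orthogonalProjectionOnto (∇ f x)

/-- The Riemannian Hessian `T_x M → T_x M`, `v ↦ P(x) (∂_v grad f (x))`, where `P(x)` is the
orthogonal projection onto `T_x M`. -/
def riemHess {d m : ℕ} (c : Fin m → EuclideanSpace ℝ (Fin d) → ℝ)
    (f : EuclideanSpace ℝ (Fin d) → ℝ) (x : EuclideanSpace ℝ (Fin d)) :
    tangentSpace c x →L[ℝ] tangentSpace c x :=
  (tangentSpace c x).orthogonalProjectionOnto ∘L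
    fderiv ℝ (fun y => (riemGrad c f y : EuclideanSpace ℝ (Fin d))) x ∘L
      (tangentSpace c x).subtypeL

/-- `ev 0 ≤ ev 1 ≤ ⋯` are the `d - m` eigenvalues of the Riemannian Hessian at `x`,
counted with multiplicity. -/
def IsHessSpectrum {d m : ℕ} (c : Fin m → EuclideanSpace ℝ (Fin d) → ℝ)
    (f : EuclideanSpace ℝ (Fin d) → ℝ) (x : EuclideanSpace ℝ (Fin d))
    (ev : Fin (d - m) → ℝ) : Prop :=
  Monotone ev ∧
    LinearMap.charpoly (riemHess c f x : tangentSpace c x →ₗ[ℝ] tangentSpace c x) =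
      ∏ i, (Polynomial.X - Polynomial.C (ev i))

/-- `x` is an index-`k` saddle point of `f` on `M`: a critical point at which the Riemannian
Hessian has exactly `k` negative eigenvalues, `k ≤ d - m - 1`. -/
def IsIndexSaddle {d m : ℕ} (c : Fin m → EuclideanSpace ℝ (Fin d) → ℝ)
    (f : EuclideanSpace ℝ (Fin d) → ℝ) (k : ℕ) (x : EuclideanSpace ℝ (Fin d)) : Prop :=
  x ∈ feasibleSet c ∧ riemGrad c f x = 0 ∧ k + m < d ∧
    ∃ ev, IsHessSpectrum c f x ev ∧ ∀ i : Fin (d - m), ev i < 0 ↔ (i : ℕ) < k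

/-- The geodesic (Riemannian) distance on `M`: the infimum of the lengths of the `C¹` curves in `M`
joining `x` to `y`; it is `∞` if there are none. -/
def geodesicEDist {d m : ℕ} (c : Fin m → EuclideanSpace ℝ (Fin d) → ℝ)
    (x y : EuclideanSpace ℝ (Fin d)) : ℝ≥0∞ :=
  ⨅ γ ∈ {γ : ℝ → EuclideanSpace ℝ (Fin d) | ContDiffOn ℝ 1 γ (Icc 0 1) ∧
      (∀ t ∈ Icc (0 : ℝ) 1, γ t ∈ feasibleSet c) ∧ γ 0 = x ∧ γ 1 = y},
    ∫⁻ t in Icc (0 : ℝ) 1, ‖derivWithin γ (Icc 0 1) t‖ₑ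

/-- The geodesic ball `U_δ = {x ∈ M | d(x, xs) < δ}`. -/
def geodesicBall {d m : ℕ} (c : Fin m → EuclideanSpace ℝ (Fin d) → ℝ)
    (xs : EuclideanSpace ℝ (Fin d)) (δ : ℝ) : Set (EuclideanSpace ℝ (Fin d)) :=
  {x | x ∈ feasibleSet c ∧ geodesicEDist c x xs < ENNReal.ofReal δ}

/-- The strict saddle assumption around `xs` with constants `δ > 0` and `L > μ > 0`: for
`x ∈ U_δ`, the `k` smallest eigenvalues of the Riemannian Hessian lie in `[-L, -μ]`, and the others
lie in `[μ, L]`. -/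
def StrictSaddle {d m : ℕ} (c : Fin m → EuclideanSpace ℝ (Fin d) → ℝ)
    (f : EuclideanSpace ℝ (Fin d) → ℝ) (k : ℕ) (xs : EuclideanSpace ℝ (Fin d))
    (δ L μ : ℝ) : Prop :=
  0 < δ ∧ 0 < μ ∧ μ < L ∧ ∀ x ∈ geodesicBall c xs δ, ∃ ev, IsHessSpectrum c f x ev ∧
    ∀ i : Fin (d - m), ((i : ℕ) < k → ev i ∈ Icc (-L) (-μ)) ∧ (k ≤ (i : ℕ) → ev i ∈ Icc μ L)

/-- A retraction on `M`: maps `Ret_x : T_x M → M`, smooth jointly in `(x, v)`, with `Ret_x(0) = x`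
and `d/dt Ret_x(t v) = v` at `t = 0`. Smoothness on the tangent bundle, as a subset of
`ℝ^d × ℝ^d`, means that near each of its points the map has a smooth extension. -/
structure IsRetraction {d m : ℕ} (c : Fin m → EuclideanSpace ℝ (Fin d) → ℝ)
    (Ret : (x : EuclideanSpace ℝ (Fin d)) → tangentSpace c x → EuclideanSpace ℝ (Fin d)) :
    Prop where
  mapsTo : ∀ x ∈ feasibleSet c, ∀ v, Ret x v ∈ feasibleSet c
  zero : ∀ x ∈ feasibleSet c, Ret x 0 = x
  hasDerivAt : ∀ x ∈ feasibleSet c, ∀ v : tangentSpace c x,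
    HasDerivAt (fun t : ℝ => Ret x (t • v)) (v : EuclideanSpace ℝ (Fin d)) 0
  smooth : ∀ x ∈ feasibleSet c, ∀ v : tangentSpace c x,
    ∃ (W : Set (EuclideanSpace ℝ (Fin d) × EuclideanSpace ℝ (Fin d)))
      (F : EuclideanSpace ℝ (Fin d) × EuclideanSpace ℝ (Fin d) → EuclideanSpace ℝ (Fin d)),
      IsOpen W ∧ (x, (v : EuclideanSpace ℝ (Fin d))) ∈ W ∧ ContDiffOn ℝ ∞ F W ∧
      ∀ y ∈ feasibleSet c, ∀ w : tangentSpace c y,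
        (y, (w : EuclideanSpace ℝ (Fin d))) ∈ W → Ret y w = F (y, (w : EuclideanSpace ℝ (Fin d)))

/-- `v₁, …, v_k ∈ T_x M` are orthonormal eigenvectors of the Riemannian Hessian at `x` associated
with its `k` smallest eigenvalues. -/
def IsExactUnstable {d m k : ℕ} (c : Fin m → EuclideanSpace ℝ (Fin d) → ℝ)
    (f : EuclideanSpace ℝ (Fin d) → ℝ) (x : EuclideanSpace ℝ (Fin d))
    (v : Fin k → tangentSpace c x) : Prop :=
  Orthonormal ℝ v ∧ ∃ ev, IsHessSpectrum c f x ev ∧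
    ∀ (i : Fin k) (j : Fin (d - m)), (j : ℕ) = i → riemHess c f x (v i) = ev j • v i

/-- `(I - 2 ∑ vᵢ vᵢᵀ) g`. -/
def householder {d m k : ℕ} {c : Fin m → EuclideanSpace ℝ (Fin d) → ℝ}
    {x : EuclideanSpace ℝ (Fin d)} (v : Fin k → tangentSpace c x) (g : tangentSpace c x) :
    tangentSpace c x :=
  g - (2 : ℝ) • ∑ i, ⟪v i, g⟫ • v i

/-- The discrete constrained saddle dynamics with exact unstable eigenvectors, retraction `Ret` and
step size `Δt`, started on `M`. -/
structure IsDiscreteCSD {d m k : ℕ} (c : Fin m → EuclideanSpace ℝ (Fin d) → ℝ)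
    (f : EuclideanSpace ℝ (Fin d) → ℝ)
    (Ret : (x : EuclideanSpace ℝ (Fin d)) → tangentSpace c x → EuclideanSpace ℝ (Fin d))
    (Δt : ℝ) (x : ℕ → EuclideanSpace ℝ (Fin d))
    (v : (n : ℕ) → Fin k → tangentSpace c (x n)) : Prop where
  init : x 0 ∈ feasibleSet c
  exact_eigenvectors : ∀ n, IsExactUnstable c f (x n) (v n)
  step : ∀ n, x (n + 1) = Ret (x n) (-Δt • householder (v n) (riemGrad c f (x n)))

end CSD

end

/-!
The geodesic distance to `xs` is compared between consecutive iterates by transporting curves,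
without any differentiability of the distance itself. Fix an iterate `x` near `xs`, a step size
`s ≤ 1 / L`, and let `R = 1 - 2 ∑ vᵢ vᵢᵀ` be the reflection used at `x`. With `P(y)` the projection
onto `T_y M`, the map `Ψ(y) = Ret_y (-s P(y) R grad f(y))` preserves `M`, fixes `xs` because
`grad f(xs) = 0`, and sends `x` to the next iterate. If `DΨ` shrinks tangent vectors near `xs` by
`q = 1 - s μ / 2`, then `Ψ` carries each short curve from `x` to `xs` to a curve from the next
iterate to `xs` that is shorter by the factor `q`, and the distances contract accordingly
(`exists_radius_geodesicEDist_step_le`).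

For `y` near `xs` and `w ∈ T_y M` one has `DΨ(y) w = w - s B w + s e`, where
`B = R Hess f(x) P(x) + μ (1 - P(x))` and `e` is small compared with `w`, uniformly in `s`
(`norm_stepDerivative_sub_le`). The factor `s` in the error makes the neighbourhood independent of
the step size; it comes from `D₁Ret(y, 0) = D₂Ret(y, 0) = 1` on `T_y M`
(`fderiv_retraction_extension`) and the vanishing of `grad f` at `xs`. As `R` is frozen at `x`, the
spectral projections of the Hessian need not vary continuously with the base point: only `grad f`,
its derivative and `P` do.

Since the Hessian is symmetric (`riemHess_isSymmetric`) and the `vᵢ` belong to its `k` lowest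
eigenvalues, the other eigenvectors carry the other eigenvalues (`exists_eigenbasis_extending`), so
`R Hess f(x)` is symmetric with spectrum in `[μ, L]` and `‖1 - s B‖ ≤ 1 - s μ`
(`norm_linearStep_le`). Half of `s μ` is left to absorb `s e`. Geodesic balls are neighbourhoods in
`M` by the inverse function theorem (`geodesicBall_mem_nhdsWithin`).
-/

namespace CSD

/-! ### Reflecting a symmetric operator across its lowest eigenspaces -/

/-- Two monotone enumerations of the roots of one polynomial coincide. -/
theorem eq_of_monotone_of_prod_X_sub_C_eq {N : ℕ} {a b : Fin N → ℝ} (ha : Monotone a)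
    (hb : Monotone b)
    (h : ∏ i, (Polynomial.X - Polynomial.C (a i)) = ∏ i, (Polynomial.X - Polynomial.C (b i))) :
    a = b := by
  have hroots : ∀ u : Fin N → ℝ, (∏ i, (Polynomial.X - Polynomial.C (u i))).roots =
      (List.ofFn u : Multiset ℝ) := by
    intro u
    have := Polynomial.roots_multiset_prod_X_sub_C (Multiset.map u Finset.univ.val)
    rw [Multiset.map_map] at this
    rw [← Fin.univ_val_map]
    exact this
  have hp : (List.ofFn a).Perm (List.ofFn b) := by
    rw [← Multiset.coe_eq_coe, ← hroots, ← hroots, h]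
  refine List.ofFn_injective (List.Perm.eq_of_pairwise (le := (· ≤ ·))
    (fun x y _ _ => le_antisymm) ?_ ?_ hp)
  · exact List.pairwise_ofFn.2 fun i j hij => ha hij.le
  · exact List.pairwise_ofFn.2 fun i j hij => hb hij.le

/-- In an orthonormal eigenbasis the characteristic polynomial is the product over the
eigenvalues. -/
theorem charpoly_eq_prod_of_eigenbasis {T ι : Type*} [NormedAddCommGroup T] [InnerProductSpace ℝ T]
    [FiniteDimensional ℝ T] [Fintype ι] [DecidableEq ι] (H : T →ₗ[ℝ] T)
    (b : OrthonormalBasis ι ℝ T) (l : ι → ℝ) (hb : ∀ i, H (b i) = l i • b i) :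
    H.charpoly = ∏ i, (Polynomial.X - Polynomial.C (l i)) := by
  rw [← LinearMap.charpoly_toMatrix H b.toBasis, ← Matrix.charpoly_diagonal]
  congr 1
  ext i j
  rw [LinearMap.toMatrix_apply, OrthonormalBasis.coe_toBasis, hb, map_smul,
    Matrix.diagonal_apply]
  rw [← OrthonormalBasis.coe_toBasis, Module.Basis.repr_self, Finsupp.smul_apply,
    Finsupp.single_apply]
  by_cases hij : i = j
  · simp [hij]
  · simp [hij, Ne.symm hij]

/-- Orthonormal eigenvectors for the `k` lowest eigenvalues extend to an orthonormal eigenbasis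
whose remaining eigenvalues are the `r` highest ones. -/
theorem exists_eigenbasis_extending {T : Type*} [NormedAddCommGroup T] [InnerProductSpace ℝ T]
    [FiniteDimensional ℝ T] {H : T →ₗ[ℝ] T} (hH : H.IsSymmetric) {k r : ℕ}
    (ev : Fin (k + r) → ℝ)
    (hchar : H.charpoly = ∏ i, (Polynomial.X - Polynomial.C (ev i)))
    {v : Fin k → T} (hv : Orthonormal ℝ v)
    (hHv : ∀ i, H (v i) = ev (Fin.castAdd r i) • v i) :
    ∃ (n : ℕ) (b : OrthonormalBasis (Fin k ⊕ Fin n) ℝ T) (l : Fin n → ℝ),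
      (∀ i, b (Sum.inl i) = v i) ∧ (∀ j, H (b (Sum.inr j)) = l j • b (Sum.inr j)) ∧
      ∀ j, ∃ i : Fin r, l j = ev (Fin.natAdd k i) := by
  set V : Submodule ℝ T := Submodule.span ℝ (range v) with hV
  have hmem : ∀ w, w ∈ Vᗮ ↔ ∀ i, ⟪v i, w⟫ = 0 := by
    intro w
    rw [Submodule.mem_orthogonal]
    refine ⟨fun h i => h _ (Submodule.subset_span ⟨i, rfl⟩), fun h u hu => ?_⟩
    induction hu using Submodule.span_induction with
    | mem x hx => obtain ⟨i, rfl⟩ := hx; exact h i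
    | zero => simp
    | add x y _ _ hx hy => rw [inner_add_left, hx, hy, add_zero]
    | smul a x _ hx => rw [real_inner_smul_left, hx, mul_zero]
  have hinv : ∀ w ∈ Vᗮ, H w ∈ Vᗮ := by
    intro w hw
    rw [hmem] at hw ⊢
    intro i
    rw [← hH, hHv, real_inner_smul_left, hw, mul_zero]
  have hH' := hH.restrict_invariant hinv
  set b' := hH'.eigenvectorBasis rfl with hb'
  have ho : Orthonormal ℝ (Sum.elim v (fun j => (b' j : T))) := by
    rw [orthonormal_iff_ite]
    have h1 := orthonormal_iff_ite.1 hv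
    have h2 := orthonormal_iff_ite.1 b'.orthonormal
    rintro (i | i) (j | j)
    · simpa using h1 i j
    · simpa using (hmem _).1 (b' j).2 i
    · simpa [real_inner_comm] using (hmem _).1 (b' i).2 j
    · simpa using h2 i j
  have hspan : ⊤ ≤ Submodule.span ℝ (range (Sum.elim v (fun j => (b' j : T)))) := by
    rw [Set.Sum.elim_range, Submodule.span_union, ← hV]
    have : Submodule.span ℝ (range fun j => (b' j : T)) = Vᗮ := by
      have h3 := b'.toBasis.span_eq
      have h4 := congrArg (Submodule.map Vᗮ.subtype) h3
      rw [Submodule.map_span, Submodule.map_top, Submodule.range_subtype, ← range_comp] at h4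
      refine Eq.trans ?_ h4
      simp [Function.comp_def]
    rw [this, Submodule.sup_orthogonal_of_hasOrthogonalProjection]
  set b := OrthonormalBasis.mk ho hspan with hb
  have hbl : ∀ i, b (Sum.inl i) = v i := fun i => by simp [hb]
  have hbr : ∀ j, b (Sum.inr j) = (b' j : T) := fun j => by simp [hb]
  have hHr : ∀ j, H (b (Sum.inr j)) = hH'.eigenvalues rfl j • b (Sum.inr j) := by
    intro j
    rw [hbr]
    exact congrArg Subtype.val (hH'.apply_eigenvectorBasis rfl j)
  refine ⟨_, b, hH'.eigenvalues rfl, hbl, hHr, fun j => ?_⟩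
  have hc := charpoly_eq_prod_of_eigenbasis H b
    (Sum.elim (fun i => ev (Fin.castAdd r i)) (hH'.eigenvalues rfl)) (by
      rintro (i | i)
      · rw [hbl]; exact hHv i
      · exact hHr i)
  rw [hchar, Fin.prod_univ_add, Fintype.prod_sum_type] at hc
  -- the factors of the prescribed eigenvectors cancel
  have hc' := mul_left_cancel₀ (Polynomial.monic_prod_of_monic _ _
    fun i _ => Polynomial.monic_X_sub_C _).ne_zero hc
  have h0 := congrArg (Polynomial.eval (hH'.eigenvalues rfl j)) hc'
  simp only [Sum.elim_inr, Polynomial.eval_prod, Polynomial.eval_sub, Polynomial.eval_X,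
    Polynomial.eval_C] at h0
  rw [Finset.prod_eq_zero (Finset.mem_univ j) (sub_self _)] at h0
  obtain ⟨i, -, hi⟩ := Finset.prod_eq_zero_iff.1 h0
  exact ⟨i, sub_eq_zero.1 hi⟩

/-- Reflecting `H` across its `k` lowest eigenvectors turns it into `|H|`, with spectrum in
`[μ, L]`, so that the step `1 - s |H|` with `s L ≤ 1` contracts by `1 - s μ`. -/
theorem norm_sub_smul_reflect_le {T : Type*} [NormedAddCommGroup T] [InnerProductSpace ℝ T]
    [FiniteDimensional ℝ T] {H : T →ₗ[ℝ] T} (hH : H.IsSymmetric) {k r : ℕ}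
    (ev : Fin (k + r) → ℝ)
    (hchar : H.charpoly = ∏ i, (Polynomial.X - Polynomial.C (ev i)))
    {v : Fin k → T} (hv : Orthonormal ℝ v)
    (hHv : ∀ i, H (v i) = ev (Fin.castAdd r i) • v i) {L μ s : ℝ}
    (hlo : ∀ i, ev (Fin.castAdd r i) ∈ Icc (-L) (-μ))
    (hhi : ∀ i, ev (Fin.natAdd k i) ∈ Icc μ L) (hs : 0 ≤ s) (hsL : s * L ≤ 1) (hsμ : s * μ ≤ 1)
    (w : T) :
    ‖w - s • (H w - (2 : ℝ) • ∑ i, ⟪v i, H w⟫ • v i)‖ ≤ (1 - s * μ) * ‖w‖ := by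
  obtain ⟨n, b, l, hbl, hbr, hl⟩ := exists_eigenbasis_extending hH ev hchar hv hHv
  refine abs_le_of_sq_le_sq' ?_ (mul_nonneg (by linarith) (norm_nonneg _)) |>.2
  rw [mul_pow, ← b.sum_sq_norm_inner_right, ← b.sum_sq_norm_inner_right w, Finset.mul_sum]
  have key : ∀ t : ℝ, t ∈ Icc μ L → ∀ z : ℝ,
      ‖z - s * (t * z)‖ ^ 2 ≤ (1 - s * μ) ^ 2 * ‖z‖ ^ 2 := by
    intro t ht z
    have h1 : s * μ ≤ s * t := mul_le_mul_of_nonneg_left ht.1 hs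
    have h2 : s * t ≤ s * L := mul_le_mul_of_nonneg_left ht.2 hs
    rw [Real.norm_eq_abs, sq_abs, Real.norm_eq_abs, sq_abs, ← mul_pow]
    calc (z - s * (t * z)) ^ 2 = (1 - s * t) ^ 2 * z ^ 2 := by ring
      _ ≤ (1 - s * μ) ^ 2 * z ^ 2 := by
        gcongr; linarith
      _ = _ := by ring
  have hbo := orthonormal_iff_ite.1 b.orthonormal
  refine Finset.sum_le_sum fun i _ => ?_
  rcases i with i | j
  · have h1 : ⟪b (Sum.inl i), H w⟫ = ev (Fin.castAdd r i) * ⟪b (Sum.inl i), w⟫ := by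
      rw [← hH, hbl, hHv, real_inner_smul_left]
    have h2 : ⟪b (Sum.inl i), ∑ i, ⟪v i, H w⟫ • v i⟫ = ⟪b (Sum.inl i), H w⟫ := by
      rw [hbl, hv.inner_right_fintype]
    rw [inner_sub_right, real_inner_smul_right, inner_sub_right, real_inner_smul_right, h2, h1]
    have := key (-ev (Fin.castAdd r i)) ⟨by linarith [(hlo i).2], by linarith [(hlo i).1]⟩
      ⟪b (Sum.inl i), w⟫
    refine le_trans (le_of_eq ?_) this
    congr 2
    ring
  · have h1 : ⟪b (Sum.inr j), H w⟫ = l j * ⟪b (Sum.inr j), w⟫ := by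
      rw [← hH, hbr, real_inner_smul_left]
    have h2 : ⟪b (Sum.inr j), ∑ i, ⟪v i, H w⟫ • v i⟫ = 0 := by
      rw [inner_sum]
      refine Finset.sum_eq_zero fun i _ => ?_
      rw [real_inner_smul_right, ← hbl, hbo]
      simp
    rw [inner_sub_right, real_inner_smul_right, inner_sub_right, real_inner_smul_right, h2, h1]
    obtain ⟨i, hi⟩ := hl j
    have := key (l j) (hi ▸ hhi i) ⟪b (Sum.inr j), w⟫
    simpa using this

/-! ### Smoothness of the tangent projection -/

/-- The orthogonal projection onto the complement of the span of linearly independent vectors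
depends smoothly on these vectors: with `A e = ∑ eᵢ aᵢ` and `B w = (⟪aᵢ, w⟫)ᵢ` it is
`1 - A (B A)⁻¹ B`. -/
theorem contDiffAt_starProjection_orthogonal_span {X E : Type*} [NormedAddCommGroup X]
    [NormedSpace ℝ X] [NormedAddCommGroup E] [InnerProductSpace ℝ E] [FiniteDimensional ℝ E]
    {m : ℕ} {a : Fin m → X → E} {x : X} {n : WithTop ℕ∞} (ha : ∀ i, ContDiffAt ℝ n (a i) x)
    (hli : LinearIndependent ℝ fun i => a i x) :
    ContDiffAt ℝ n
      (fun y => (Submodule.span ℝ (range fun i => a i y))ᗮ.starProjection) x := by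
  let A : X → (Fin m → ℝ) →L[ℝ] E := fun y =>
    ∑ i, (ContinuousLinearMap.proj (R := ℝ) (φ := fun _ : Fin m => ℝ) i).smulRight (a i y)
  let B : X → E →L[ℝ] (Fin m → ℝ) := fun y =>
    ∑ i, (innerSL ℝ (a i y)).smulRight (Pi.single i (1 : ℝ) : Fin m → ℝ)
  have hA_apply : ∀ y e, A y e = ∑ i, e i • a i y := fun y e => by
    simp [A]
  have hB_apply : ∀ y w i, B y w i = ⟪a i y, w⟫ := fun y w i => by
    simp [B, Finset.sum_apply, Pi.single_apply]
  have hA : ContDiffAt ℝ n A x := by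
    refine ContDiffAt.sum fun i _ => ?_
    exact ((ContinuousLinearMap.smulRightL ℝ (Fin m → ℝ) E
      (ContinuousLinearMap.proj (R := ℝ) (φ := fun _ : Fin m => ℝ) i)).contDiff.contDiffAt).comp x
      (ha i)
  have hB : ContDiffAt ℝ n B x := by
    refine ContDiffAt.sum fun i _ => ?_
    have h1 : ContDiffAt ℝ n (fun y => innerSL ℝ (a i y)) x :=
      ((innerSL ℝ : E →L[ℝ] E →L[ℝ] ℝ).contDiff.contDiffAt).comp x (ha i)
    exact h1.smulRight contDiffAt_const
  have hinj : Function.Injective (B x ∘L A x) := by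
    rw [injective_iff_map_eq_zero]
    intro e he
    have h0 : A x e = 0 := by
      rw [← inner_self_eq_zero (𝕜 := ℝ)]
      nth_rewrite 1 [hA_apply]
      rw [sum_inner]
      refine Finset.sum_eq_zero fun i _ => ?_
      have := congrFun he i
      rw [ContinuousLinearMap.comp_apply, hB_apply] at this
      rw [real_inner_smul_left, this]
      simp
    rw [hA_apply] at h0
    exact funext (Fintype.linearIndependent_iff.1 hli e h0)
  let G : (Fin m → ℝ) ≃L[ℝ] (Fin m → ℝ) :=
    (LinearEquiv.ofInjectiveEndo (B x ∘L A x : (Fin m → ℝ) →ₗ[ℝ] (Fin m → ℝ))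
      hinj).toContinuousLinearEquiv
  have hG : (G : (Fin m → ℝ) →L[ℝ] (Fin m → ℝ)) = B x ∘L A x := by
    ext e; rfl
  have hBA : ContDiffAt ℝ n (fun y => B y ∘L A y) x := hB.clm_comp hA
  have hinv : ContDiffAt ℝ n (fun y => (B y ∘L A y).inverse) x := by
    refine ContDiffAt.comp (g := ContinuousLinearMap.inverse) x ?_ hBA
    rw [← hG]
    exact contDiffAt_map_inverse G
  have hS : ContDiffAt ℝ n
      (fun y => ContinuousLinearMap.id ℝ E - A y ∘L ((B y ∘L A y).inverse ∘L B y)) x :=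
    contDiffAt_const.sub (hA.clm_comp (hinv.clm_comp hB))
  refine hS.congr_of_eventuallyEq ?_
  have hev : ∀ᶠ y in 𝓝 x, (B y ∘L A y) ∈
      range ((↑) : ((Fin m → ℝ) ≃L[ℝ] (Fin m → ℝ)) → _) := by
    refine hBA.continuousAt.eventually_mem ?_
    exact hG ▸ G.nhds
  filter_upwards [hev] with y hy
  obtain ⟨e, he⟩ := hy
  ext1 w
  have hspan : ∀ z, A y z ∈ Submodule.span ℝ (range fun i => a i y) := fun z => by
    rw [hA_apply]
    exact Submodule.sum_mem _ fun i _ =>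
      Submodule.smul_mem _ _ (Submodule.subset_span ⟨i, rfl⟩)
  refine Submodule.eq_starProjection_of_mem_orthogonal ?_ ?_
  · rw [Submodule.mem_orthogonal]
    intro u hu
    induction hu using Submodule.span_induction with
    | mem u hu =>
      obtain ⟨i, rfl⟩ := hu
      rw [← hB_apply, ← he]
      simp only [sub_apply, ContinuousLinearMap.comp_apply,
        ContinuousLinearMap.id_apply, map_sub, ContinuousLinearMap.inverse_equiv]
      rw [← ContinuousLinearMap.comp_apply (B y) (A y), ← he]
      simp
    | zero => simp
    | add u u' _ _ h h' => rw [inner_add_left, h, h', add_zero]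
    | smul t u _ h => rw [real_inner_smul_left, h, mul_zero]
  · rw [Submodule.orthogonal_orthogonal]
    simpa using hspan _

variable {d m k : ℕ}

theorem contDiff_gradient {f : EuclideanSpace ℝ (Fin d) → ℝ} (hf : ContDiff ℝ ∞ f) :
    ContDiff ℝ ∞ (∇ f) := by
  rw [contDiff_euclidean]
  intro i
  have h : (fun x => (∇ f x) i) = fun x => fderiv ℝ f x (EuclideanSpace.single i (1 : ℝ)) := by
    ext x
    rw [← inner_gradient_left, EuclideanSpace.inner_single_right]
    simp
  rw [h]
  exact (hf.fderiv_right (by simp)).clm_apply contDiff_const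

theorem mem_tangentSpace_iff {c : Fin m → EuclideanSpace ℝ (Fin d) → ℝ}
    {x w : EuclideanSpace ℝ (Fin d)} :
    w ∈ tangentSpace c x ↔ ∀ i, fderiv ℝ (c i) x w = 0 := by
  rw [tangentSpace, normalSpace, Submodule.mem_orthogonal]
  simp_rw [← inner_gradient_left]
  refine ⟨fun h i => h _ (Submodule.subset_span ⟨i, rfl⟩), fun h u hu => ?_⟩
  induction hu using Submodule.span_induction with
  | mem x hx => obtain ⟨i, rfl⟩ := hx; exact h i
  | zero => simp
  | add x y _ _ hx hy => rw [inner_add_left, hx, hy, add_zero]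
  | smul a x _ hx => rw [real_inner_smul_left, hx, mul_zero]

/-- The orthogonal projection `P(x)` onto `T_x M`, as an operator of `ℝ^d`. -/
noncomputable def tangentProj (c : Fin m → EuclideanSpace ℝ (Fin d) → ℝ)
    (x : EuclideanSpace ℝ (Fin d)) : EuclideanSpace ℝ (Fin d) →L[ℝ] EuclideanSpace ℝ (Fin d) :=
  (tangentSpace c x).starProjection

/-- The Riemannian gradient as a vector field of `ℝ^d`. -/
noncomputable def gradField (c : Fin m → EuclideanSpace ℝ (Fin d) → ℝ)
    (f : EuclideanSpace ℝ (Fin d) → ℝ) (x : EuclideanSpace ℝ (Fin d)) :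
    EuclideanSpace ℝ (Fin d) :=
  riemGrad c f x

theorem gradField_eq (c : Fin m → EuclideanSpace ℝ (Fin d) → ℝ)
    (f : EuclideanSpace ℝ (Fin d) → ℝ) (x : EuclideanSpace ℝ (Fin d)) :
    gradField c f x = tangentProj c x (∇ f x) := rfl

theorem contDiffAt_tangentProj {c : Fin m → EuclideanSpace ℝ (Fin d) → ℝ}
    (hc : ∀ i, ContDiff ℝ ∞ (c i)) (hLICQ : LICQ c) {x : EuclideanSpace ℝ (Fin d)}
    (hx : x ∈ feasibleSet c) : ContDiffAt ℝ ∞ (tangentProj c) x :=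
  contDiffAt_starProjection_orthogonal_span (a := fun i y => ∇ (c i) y)
    (fun i => (contDiff_gradient (hc i)).contDiffAt) (hLICQ x hx)

theorem contDiffAt_gradField {c : Fin m → EuclideanSpace ℝ (Fin d) → ℝ}
    {f : EuclideanSpace ℝ (Fin d) → ℝ} (hf : ContDiff ℝ ∞ f)
    (hc : ∀ i, ContDiff ℝ ∞ (c i)) (hLICQ : LICQ c) {x : EuclideanSpace ℝ (Fin d)}
    (hx : x ∈ feasibleSet c) : ContDiffAt ℝ ∞ (gradField c f) x :=
  (contDiffAt_tangentProj hc hLICQ hx).clm_apply (contDiff_gradient hf).contDiffAt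

/-! ### Symmetry of the Riemannian Hessian -/

theorem inner_fderiv_gradient_comm {f : EuclideanSpace ℝ (Fin d) → ℝ} (hf : ContDiff ℝ ∞ f)
    (x v w : EuclideanSpace ℝ (Fin d)) :
    ⟪fderiv ℝ (∇ f) x v, w⟫ = ⟪v, fderiv ℝ (∇ f) x w⟫ := by
  have hd : DifferentiableAt ℝ (∇ f) x := (contDiff_gradient hf).differentiable (by simp) x
  have key : ∀ v w, ⟪fderiv ℝ (∇ f) x v, w⟫ = fderiv ℝ (fderiv ℝ f) x v w := by
    intro v w
    have hd' : DifferentiableAt ℝ (fderiv ℝ f) x :=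
      (hf.fderiv_right (m := ∞) (by simp)).differentiable (by simp) x
    have h1 : (fun y => ⟪∇ f y, w⟫) = fun y => fderiv ℝ f y w :=
      funext fun y => inner_gradient_left
    have h2 := congrArg (fun F => fderiv ℝ F x v) h1
    have e1 : HasFDerivAt (fun y => ⟪∇ f y, w⟫) _ x :=
      hd.hasFDerivAt.inner ℝ (hasFDerivAt_const w x)
    have e2 : HasFDerivAt (fun y => fderiv ℝ f y w) _ x :=
      hd'.hasFDerivAt.clm_apply (hasFDerivAt_const w x)
    simp only [e1.fderiv, e2.fderiv] at h2
    simpa using h2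
  rw [key, real_inner_comm, key]
  exact (hf.contDiffAt.isSymmSndFDerivAt 
    (by simpa using WithTop.coe_le_coe.2 (le_top : (2 : ℕ∞) ≤ ⊤))) v w

/-- The Hessian is the compression to `T_x M` of the second derivative of the Lagrangian
`f - ∑ λᵢ cᵢ` whose multipliers make `∇ f (x) - ∑ λᵢ ∇ cᵢ (x)` tangent. The multipliers may be
frozen at `x` because `P ∇ cᵢ` vanishes identically. -/
theorem riemHess_isSymmetric {c : Fin m → EuclideanSpace ℝ (Fin d) → ℝ}
    {f : EuclideanSpace ℝ (Fin d) → ℝ} (hf : ContDiff ℝ ∞ f)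
    (hc : ∀ i, ContDiff ℝ ∞ (c i)) (hLICQ : LICQ c) {x : EuclideanSpace ℝ (Fin d)}
    (hx : x ∈ feasibleSet c) :
    (riemHess c f x : tangentSpace c x →ₗ[ℝ] tangentSpace c x).IsSymmetric := by
  have hn : ∇ f x - tangentProj c x (∇ f x) ∈ normalSpace c x := by
    have := Submodule.sub_starProjection_mem_orthogonal (K := tangentSpace c x) (∇ f x)
    rwa [tangentSpace, Submodule.orthogonal_orthogonal] at this
  obtain ⟨l, hl⟩ := (Submodule.mem_span_range_iff_exists_fun ℝ).1 hn
  set h : EuclideanSpace ℝ (Fin d) → ℝ := fun y => f y - ∑ i, l i * c i y with hh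
  have hhs : ContDiff ℝ ∞ h :=
    hf.sub (ContDiff.sum fun i _ => contDiff_const.mul (hc i))
  have hgrad : ∀ y, ∇ h y = ∇ f y - ∑ i, l i • ∇ (c i) y := by
    intro y
    refine ext_inner_right ℝ fun w => ?_
    have hd : HasFDerivAt h (fderiv ℝ f y - ∑ i, l i • fderiv ℝ (c i) y) y :=
      (hf.differentiable (by simp) y).hasFDerivAt.sub
        (HasFDerivAt.fun_sum fun i _ =>
          ((hc i).differentiable (by simp) y).hasFDerivAt.const_mul (l i))
    rw [inner_gradient_left, hd.fderiv, inner_sub_left, sum_inner]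
    simp [inner_gradient_left, real_inner_smul_left]
  have hPc : ∀ y i, tangentProj c y (∇ (c i) y) = 0 := by
    intro y i
    refine (Submodule.starProjection_apply_eq_zero_iff _).2 ?_
    rw [tangentSpace, Submodule.orthogonal_orthogonal]
    exact Submodule.subset_span ⟨i, rfl⟩
  have hfield : gradField c f = fun y => tangentProj c y (∇ h y) := by
    ext1 y
    rw [gradField_eq, hgrad, map_sub, map_sum]
    simp [hPc]
  have hPd : DifferentiableAt ℝ (tangentProj c) x :=
    (contDiffAt_tangentProj hc hLICQ hx).differentiableAt (by simp)
  have hhd : DifferentiableAt ℝ (∇ h) x :=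
    (contDiff_gradient hhs).differentiable (by simp) x
  have htan : ∇ h x = tangentProj c x (∇ h x) := by
    rw [hgrad, map_sub, map_sum]
    simp [hPc, hl]
  have hproj : ∀ (w : EuclideanSpace ℝ (Fin d)) (u : tangentSpace c x),
      ⟪tangentProj c x w, (u : EuclideanSpace ℝ (Fin d))⟫ =
        ⟪w, (u : EuclideanSpace ℝ (Fin d))⟫ := by
    intro w u
    rw [tangentProj, Submodule.inner_starProjection_left_eq_right,
      Submodule.starProjection_eq_self_iff.2 u.2]
  -- differentiating `P = P * P` shows that `P' v` has no tangent-tangent component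
  have hDP : ∀ v w, tangentProj c x (fderiv ℝ (tangentProj c) x v (tangentProj c x w)) = 0 := by
    intro v w
    have hidem : (fun y => tangentProj c y ∘L tangentProj c y) = tangentProj c := by
      ext1 y
      ext1 z
      exact Submodule.starProjection_eq_self_iff.2 (Submodule.starProjection_apply_mem _ _)
    have e1 := (hPd.hasFDerivAt.clm_comp hPd.hasFDerivAt).fderiv
    rw [hidem] at e1
    have e2 := congrArg (fun F => tangentProj c x (F v (tangentProj c x w))) e1
    have hid : ∀ z, tangentProj c x (tangentProj c x z) = tangentProj c x z := fun z =>
      Submodule.starProjection_eq_self_iff.2 (Submodule.starProjection_apply_mem _ _)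
    simpa [hid] using e2
  have key : ∀ v u : tangentSpace c x, ⟪riemHess c f x v, u⟫ =
      ⟪fderiv ℝ (∇ h) x v, (u : EuclideanSpace ℝ (Fin d))⟫ := by
    intro v u
    have e0 : ((riemHess c f x v : tangentSpace c x) : EuclideanSpace ℝ (Fin d)) =
        tangentProj c x (fderiv ℝ (gradField c f) x v) := rfl
    have e1 := (hPd.hasFDerivAt.clm_apply hhd.hasFDerivAt).fderiv
    rw [Submodule.coe_inner, e0, hfield, e1]
    simp only [add_apply, ContinuousLinearMap.comp_apply,
      ContinuousLinearMap.flip_apply, map_add]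
    rw [htan, hDP, add_zero, hproj, hproj]
  intro v u
  have h2 := key u v
  simp only [ContinuousLinearMap.coe_coe]
  rw [key, inner_fderiv_gradient_comm hhs, real_inner_comm, ← h2, real_inner_comm]

/-! ### Curves and the geodesic distance -/

/-- `γ` restricted to `[0, 1]` is a `C¹` curve in `M` from `x` to `y`: a competitor in the
definition of the geodesic distance. -/
def IsCurve (c : Fin m → EuclideanSpace ℝ (Fin d) → ℝ) (x y : EuclideanSpace ℝ (Fin d))
    (γ : ℝ → EuclideanSpace ℝ (Fin d)) : Prop :=
  ContDiffOn ℝ 1 γ (Icc 0 1) ∧ (∀ t ∈ Icc (0 : ℝ) 1, γ t ∈ feasibleSet c) ∧ γ 0 = x ∧ γ 1 = y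

/-- The length of the curve `γ` over `[0, 1]`. -/
noncomputable def curveLength (γ : ℝ → EuclideanSpace ℝ (Fin d)) : ℝ≥0∞ :=
  ∫⁻ t in Icc (0 : ℝ) 1, ‖derivWithin γ (Icc 0 1) t‖ₑ

theorem geodesicEDist_le_curveLength {c : Fin m → EuclideanSpace ℝ (Fin d) → ℝ}
    {x y : EuclideanSpace ℝ (Fin d)} {γ : ℝ → EuclideanSpace ℝ (Fin d)} (h : IsCurve c x y γ) :
    geodesicEDist c x y ≤ curveLength γ :=
  iInf₂_le (α := ℝ≥0∞) γ h

theorem exists_curveLength_lt {c : Fin m → EuclideanSpace ℝ (Fin d) → ℝ}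
    {x y : EuclideanSpace ℝ (Fin d)} {a : ℝ≥0∞} (h : geodesicEDist c x y < a) :
    ∃ γ, IsCurve c x y γ ∧ curveLength γ < a := by
  obtain ⟨γ, hγ⟩ := iInf_lt_iff.1 h
  obtain ⟨hγ, hlt⟩ := iInf_lt_iff.1 hγ
  exact ⟨γ, hγ, hlt⟩

theorem edist_le_curveLength {c : Fin m → EuclideanSpace ℝ (Fin d) → ℝ}
    {x y : EuclideanSpace ℝ (Fin d)} {γ : ℝ → EuclideanSpace ℝ (Fin d)} (h : IsCurve c x y γ)
    {t : ℝ} (ht : t ∈ Icc (0 : ℝ) 1) : edist (γ t) y ≤ curveLength γ := by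
  have hsub : Icc t 1 ⊆ Icc (0 : ℝ) 1 := Icc_subset_Icc_left ht.1
  rw [edist_comm, edist_eq_enorm_sub, ← h.2.2.2]
  calc ‖γ 1 - γ t‖ₑ ≤ ∫⁻ s in Icc t 1, ‖deriv γ s‖ₑ :=
        enorm_sub_le_lintegral_deriv_of_contDiffOn_Icc (h.1.mono hsub) ht.2
    _ ≤ ∫⁻ s in Icc (0 : ℝ) 1, ‖deriv γ s‖ₑ := lintegral_mono_set hsub
    _ = curveLength γ := by
        refine lintegral_congr_ae ?_
        rw [← restrict_Ioo_eq_restrict_Icc]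
        filter_upwards [self_mem_ae_restrict measurableSet_Ioo] with s hs
        rw [derivWithin_of_mem_nhds (Icc_mem_nhds hs.1 hs.2)]

theorem edist_le_geodesicEDist {c : Fin m → EuclideanSpace ℝ (Fin d) → ℝ}
    {x y : EuclideanSpace ℝ (Fin d)} : edist x y ≤ geodesicEDist c x y := by
  refine le_iInf₂ fun γ hγ => ?_
  have := edist_le_curveLength (c := c) (x := x) (y := y) hγ (t := 0) (by simp)
  rwa [hγ.2.2.1] at this

theorem IsCurve.derivWithin_mem_tangentSpace {c : Fin m → EuclideanSpace ℝ (Fin d) → ℝ}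
    (hc : ∀ i, ContDiff ℝ ∞ (c i)) {x y : EuclideanSpace ℝ (Fin d)}
    {γ : ℝ → EuclideanSpace ℝ (Fin d)} (h : IsCurve c x y γ) {t : ℝ} (ht : t ∈ Icc (0 : ℝ) 1) :
    derivWithin γ (Icc 0 1) t ∈ tangentSpace c (γ t) := by
  rw [mem_tangentSpace_iff]
  intro i
  have h1 := (h.1.differentiableOn one_ne_zero t ht).hasDerivWithinAt
  have h2 := ((hc i).differentiable (by simp) (γ t)).hasFDerivAt.comp_hasDerivWithinAt t h1
  have h3 : HasDerivWithinAt (c i ∘ γ) 0 (Icc 0 1) t :=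
    (hasDerivWithinAt_const t _ (0 : ℝ)).congr (fun s hs => h.2.1 s hs i) (h.2.1 t ht i)
  exact (uniqueDiffOn_Icc_zero_one t ht).eq_deriv _ h2 h3

/-- A map of `M` into itself that shrinks tangent vectors along a curve shrinks its length. -/
theorem IsCurve.comp {c : Fin m → EuclideanSpace ℝ (Fin d) → ℝ}
    (hc : ∀ i, ContDiff ℝ ∞ (c i)) {x y : EuclideanSpace ℝ (Fin d)}
    {γ : ℝ → EuclideanSpace ℝ (Fin d)} (h : IsCurve c x y γ)
    {Ψ : EuclideanSpace ℝ (Fin d) → EuclideanSpace ℝ (Fin d)} {q : ℝ}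
    (hΨ : ∀ t ∈ Icc (0 : ℝ) 1, ContDiffAt ℝ 1 Ψ (γ t) ∧ Ψ (γ t) ∈ feasibleSet c ∧
      ∀ w ∈ tangentSpace c (γ t), ‖fderiv ℝ Ψ (γ t) w‖ ≤ q * ‖w‖) :
    IsCurve c (Ψ x) (Ψ y) (Ψ ∘ γ) ∧ curveLength (Ψ ∘ γ) ≤ ENNReal.ofReal q * curveLength γ := by
  refine ⟨⟨fun t ht => (hΨ t ht).1.comp_contDiffWithinAt t (h.1 t ht), fun t ht => (hΨ t ht).2.1,
    by simp [h.2.2.1], by simp [h.2.2.2]⟩, ?_⟩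
  rw [curveLength, curveLength, ← lintegral_const_mul' _ _ ENNReal.ofReal_ne_top]
  refine setLIntegral_mono' measurableSet_Icc fun t ht => ?_
  have h1 := (h.1.differentiableOn one_ne_zero t ht).hasDerivWithinAt
  have h2 := ((hΨ t ht).1.differentiableAt one_ne_zero).hasFDerivAt.comp_hasDerivWithinAt t h1
  rw [h2.derivWithin (uniqueDiffOn_Icc_zero_one t ht)]
  have h3 := (hΨ t ht).2.2 _ (h.derivWithin_mem_tangentSpace hc ht)
  rw [← ofReal_norm, ← ofReal_norm, ← ENNReal.ofReal_mul' (norm_nonneg _)]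
  exact ENNReal.ofReal_le_ofReal h3

theorem eq_zero_of_sum_smul_gradient_mem {c : Fin m → EuclideanSpace ℝ (Fin d) → ℝ}
    (hLICQ : LICQ c) {x : EuclideanSpace ℝ (Fin d)} (hx : x ∈ feasibleSet c) {l : Fin m → ℝ}
    (h : ∑ i, l i • ∇ (c i) x ∈ tangentSpace c x) : ∀ i, l i = 0 := by
  have hn : ∑ i, l i • ∇ (c i) x ∈ normalSpace c x :=
    Submodule.sum_mem _ fun i _ => Submodule.smul_mem _ _ (Submodule.subset_span ⟨i, rfl⟩)
  have h0 := (Submodule.mem_orthogonal _ _).1 h _ hn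
  exact Fintype.linearIndependent_iff.1 (hLICQ x hx) l (inner_self_eq_zero.1 h0)

/-- The map `y ↦ P (y - x) + ∑ cᵢ(y) ∇ cᵢ(x)` straightens `M` near `x`: it is a local
diffeomorphism taking `M` to `T_x M`. Segments in `T_x M` pull back to short curves in `M`. -/
theorem geodesicBall_mem_nhdsWithin {c : Fin m → EuclideanSpace ℝ (Fin d) → ℝ}
    (hc : ∀ i, ContDiff ℝ ∞ (c i)) (hLICQ : LICQ c) {x : EuclideanSpace ℝ (Fin d)}
    (hx : x ∈ feasibleSet c) {r : ℝ} (hr : 0 < r) :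
    geodesicBall c x r ∈ 𝓝[feasibleSet c] x := by
  set Φ : EuclideanSpace ℝ (Fin d) → EuclideanSpace ℝ (Fin d) :=
    fun y => tangentProj c x (y - x) + ∑ i, c i y • ∇ (c i) x with hΦdef
  have hΦ : ContDiff ℝ ∞ Φ :=
    ((tangentProj c x).contDiff.comp (contDiff_id.sub contDiff_const)).add
      (ContDiff.sum fun i _ => (hc i).smul contDiff_const)
  have hPmem : ∀ w, tangentProj c x w ∈ tangentSpace c x := fun w =>
    Submodule.starProjection_apply_mem _ _
  set Φ' : EuclideanSpace ℝ (Fin d) →L[ℝ] EuclideanSpace ℝ (Fin d) :=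
    tangentProj c x + ∑ i, (fderiv ℝ (c i) x).smulRight (∇ (c i) x) with hΦ'def
  have hΦ' : HasFDerivAt Φ Φ' x := by
    refine HasFDerivAt.add ?_ (HasFDerivAt.fun_sum fun i _ => ?_)
    · exact (tangentProj c x).hasFDerivAt.comp x ((hasFDerivAt_id x).sub_const x)
    · exact ((hc i).differentiable (by simp) x).hasFDerivAt.smul_const _
  have hinj : Function.Injective Φ' := by
    rw [injective_iff_map_eq_zero]
    intro w hw
    have hw' : tangentProj c x w + ∑ i, fderiv ℝ (c i) x w • ∇ (c i) x = 0 := by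
      simpa [hΦ'def] using hw
    have h0 : ∀ i, fderiv ℝ (c i) x w = 0 := by
      refine eq_zero_of_sum_smul_gradient_mem hLICQ hx ?_
      rw [← neg_eq_of_add_eq_zero_right hw']
      exact Submodule.neg_mem _ (hPmem w)
    have hwt : w ∈ tangentSpace c x := mem_tangentSpace_iff.2 h0
    have : tangentProj c x w = w := Submodule.starProjection_eq_self_iff.2 hwt
    simpa [h0, this] using hw'
  let e : EuclideanSpace ℝ (Fin d) ≃L[ℝ] EuclideanSpace ℝ (Fin d) :=
    (LinearEquiv.ofInjectiveEndo (Φ' : EuclideanSpace ℝ (Fin d) →ₗ[ℝ] EuclideanSpace ℝ (Fin d))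
      hinj).toContinuousLinearEquiv
  have he : HasFDerivAt Φ (e : EuclideanSpace ℝ (Fin d) →L[ℝ] EuclideanSpace ℝ (Fin d)) x := hΦ'
  have hΦ1 : ContDiffAt ℝ 1 Φ x := hΦ.contDiffAt.of_le (by simp)
  set Ξ := hΦ1.toOpenPartialHomeomorph Φ he one_ne_zero with hΞ
  have hΞc : (Ξ : EuclideanSpace ℝ (Fin d) → EuclideanSpace ℝ (Fin d)) = Φ :=
    hΦ1.toOpenPartialHomeomorph_coe he one_ne_zero
  have hxs : x ∈ Ξ.source := hΦ1.mem_toOpenPartialHomeomorph_source he one_ne_zero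
  have hΦx : Φ x = 0 := by simp [hΦdef, hx _]
  have h0t : (0 : EuclideanSpace ℝ (Fin d)) ∈ Ξ.target := by
    rw [← hΦx, ← hΞc]; exact Ξ.map_source hxs
  have hψ : ContDiffAt ℝ 1 Ξ.symm 0 := by
    have := hΦ1.to_localInverse he one_ne_zero
    rwa [hΦx] at this
  set K : ℝ := ‖fderiv ℝ Ξ.symm 0‖ + 1 with hK
  have hKpos : 0 < K := by positivity
  have hev : ∀ᶠ u in 𝓝 (0 : EuclideanSpace ℝ (Fin d)),
      u ∈ Ξ.target ∧ ContDiffAt ℝ 1 Ξ.symm u ∧ ‖fderiv ℝ Ξ.symm u‖ < K := by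
    refine (Ξ.open_target.eventually_mem h0t).and ((hψ.eventually (by simp)).and ?_)
    have h1 : ContinuousAt (fun u => ‖fderiv ℝ Ξ.symm u‖) 0 :=
      (hψ.fderiv_right (m := 0) (by simp)).continuousAt.norm
    exact h1.eventually_lt_const (by simp [hK])
  obtain ⟨ρ, hρ, hball⟩ := Metric.eventually_nhds_iff_ball.1 hev
  have hsmall : ∀ᶠ y in 𝓝 x, y ∈ Ξ.source ∧ ‖Φ y‖ < min ρ (r / K) := by
    refine (Ξ.open_source.eventually_mem hxs).and ?_
    have h1 : ContinuousAt (fun y => ‖Φ y‖) x := hΦ.continuous.continuousAt.norm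
    exact h1.eventually_lt_const (by simp only [hΦx, norm_zero]; positivity)
  filter_upwards [hsmall.filter_mono nhdsWithin_le_nhds, self_mem_nhdsWithin] with y hy hyM
  refine ⟨hyM, ?_⟩
  have hΦy : Φ y ∈ tangentSpace c x := by
    have : Φ y = tangentProj c x (y - x) := by simp [hΦdef, hyM _]
    rw [this]; exact hPmem _
  set γ : ℝ → EuclideanSpace ℝ (Fin d) := fun t => Ξ.symm ((1 - t) • Φ y) with hγ
  have hin : ∀ t ∈ Icc (0 : ℝ) 1, (1 - t) • Φ y ∈ Metric.ball 0 ρ := by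
    intro t ht
    rw [mem_ball_zero_iff, norm_smul, Real.norm_of_nonneg (by linarith [ht.2])]
    calc (1 - t) * ‖Φ y‖ ≤ 1 * ‖Φ y‖ := by gcongr; linarith [ht.1]
      _ < ρ := by rw [one_mul]; exact hy.2.trans_le (min_le_left _ _)
  have hder : ∀ t ∈ Icc (0 : ℝ) 1,
      HasDerivAt γ (fderiv ℝ Ξ.symm ((1 - t) • Φ y) (-Φ y)) t := by
    intro t ht
    have h1 : HasDerivAt (fun t : ℝ => (1 - t) • Φ y) (-Φ y) t := by
      simpa using ((hasDerivAt_id t).const_sub 1).smul_const (Φ y)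
    exact ((hball _ (hin t ht)).2.1.differentiableAt
      one_ne_zero).hasFDerivAt.comp_hasDerivAt t h1
  have hcurve : IsCurve c y x γ := by
    refine ⟨fun t ht => ?_, fun t ht => ?_, ?_, ?_⟩
    · refine ContDiffAt.contDiffWithinAt ?_
      exact (hball _ (hin t ht)).2.1.comp t
        ((contDiffAt_const.sub contDiffAt_id).smul contDiffAt_const)
    · have h1 : Φ (γ t) = (1 - t) • Φ y := by
        rw [← hΞc]; exact Ξ.right_inv (hball _ (hin t ht)).1
      have h2 : ∑ i, c i (γ t) • ∇ (c i) x = (1 - t) • Φ y - tangentProj c x (γ t - x) := by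
        rw [← h1, hΦdef]; simp
      refine eq_zero_of_sum_smul_gradient_mem hLICQ hx (l := fun i => c i (γ t)) ?_
      rw [h2]
      exact Submodule.sub_mem _ (Submodule.smul_mem _ _ hΦy) (hPmem _)
    · simp only [hγ, sub_zero, one_smul, ← hΞc]
      exact Ξ.left_inv hy.1
    · simp only [hγ, sub_self, zero_smul, ← hΦx, ← hΞc]
      exact Ξ.left_inv hxs
  have hlen : curveLength γ ≤ ENNReal.ofReal (K * ‖Φ y‖) := by
    calc curveLength γ ≤ ∫⁻ _ in Icc (0 : ℝ) 1, ENNReal.ofReal (K * ‖Φ y‖) := by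
          refine setLIntegral_mono' measurableSet_Icc fun t ht => ?_
          rw [((hder t ht).hasDerivWithinAt).derivWithin (uniqueDiffOn_Icc_zero_one t ht),
            ← ofReal_norm]
          refine ENNReal.ofReal_le_ofReal ((ContinuousLinearMap.le_opNorm _ _).trans ?_)
          rw [norm_neg]
          gcongr
          exact (hball _ (hin t ht)).2.2.le
      _ = _ := by simp
  refine (geodesicEDist_le_curveLength hcurve).trans_lt (hlen.trans_lt ?_)
  refine (ENNReal.ofReal_lt_ofReal_iff hr).2 ?_
  have := (lt_div_iff₀ hKpos).1 (hy.2.trans_le (min_le_right _ _))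
  linarith

/-! ### The reflection across the unstable directions -/

/-- The Householder operator `1 - 2 ∑ vᵢ vᵢᵀ` on the ambient space. -/
noncomputable def householderOp {E : Type*} [NormedAddCommGroup E] [InnerProductSpace ℝ E]
    (v : Fin k → E) : E →L[ℝ] E :=
  ContinuousLinearMap.id ℝ E - (2 : ℝ) • ∑ i, (innerSL ℝ (v i)).smulRight (v i)

theorem householderOp_apply {E : Type*} [NormedAddCommGroup E] [InnerProductSpace ℝ E]
    (v : Fin k → E) (w : E) : householderOp v w = w - (2 : ℝ) • ∑ i, ⟪v i, w⟫ • v i := by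
  simp [householderOp]

theorem norm_householderOp_apply {E : Type*} [NormedAddCommGroup E] [InnerProductSpace ℝ E]
    {v : Fin k → E} (hv : Orthonormal ℝ v) (w : E) : ‖householderOp v w‖ = ‖w‖ := by
  have h1 : ⟪w, ∑ i, ⟪v i, w⟫ • v i⟫ = ∑ i, ⟪v i, w⟫ * ⟪v i, w⟫ := by
    rw [inner_sum]
    exact Finset.sum_congr rfl fun i _ => by rw [real_inner_smul_right, real_inner_comm w]
  have h2 : ⟪∑ i, ⟪v i, w⟫ • v i, ∑ i, ⟪v i, w⟫ • v i⟫ = ∑ i, ⟪v i, w⟫ * ⟪v i, w⟫ := by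
    rw [hv.inner_sum]
    simp
  rw [← sq_eq_sq₀ (norm_nonneg _) (norm_nonneg _), householderOp_apply, norm_sub_sq_real,
    real_inner_smul_right, h1, norm_smul, mul_pow, ← real_inner_self_eq_norm_sq (∑ i, _), h2]
  norm_num
  ring

theorem coe_householder {c : Fin m → EuclideanSpace ℝ (Fin d) → ℝ}
    {x : EuclideanSpace ℝ (Fin d)} (v : Fin k → tangentSpace c x) (g : tangentSpace c x) :
    (householder v g : EuclideanSpace ℝ (Fin d)) =
      householderOp (fun i => (v i : EuclideanSpace ℝ (Fin d))) g := by
  rw [householderOp_apply, householder]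
  simp

theorem norm_tangentProj_apply_le (c : Fin m → EuclideanSpace ℝ (Fin d) → ℝ)
    (x w : EuclideanSpace ℝ (Fin d)) : ‖tangentProj c x w‖ ≤ ‖w‖ :=
  Submodule.norm_starProjection_apply_le _ w

theorem tangentProj_apply_mem (c : Fin m → EuclideanSpace ℝ (Fin d) → ℝ)
    (x w : EuclideanSpace ℝ (Fin d)) : tangentProj c x w ∈ tangentSpace c x :=
  Submodule.starProjection_apply_mem _ w

theorem tangentProj_eq_self {c : Fin m → EuclideanSpace ℝ (Fin d) → ℝ}
    {x w : EuclideanSpace ℝ (Fin d)} (hw : w ∈ tangentSpace c x) : tangentProj c x w = w :=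
  Submodule.starProjection_eq_self_iff.2 hw

theorem householderOp_tangentProj_comm {c : Fin m → EuclideanSpace ℝ (Fin d) → ℝ}
    {x : EuclideanSpace ℝ (Fin d)} (v : Fin k → tangentSpace c x)
    (w : EuclideanSpace ℝ (Fin d)) :
    householderOp (fun i => (v i : EuclideanSpace ℝ (Fin d))) (tangentProj c x w) =
      tangentProj c x (householderOp (fun i => (v i : EuclideanSpace ℝ (Fin d))) w) := by
  rw [householderOp_apply, householderOp_apply, map_sub, map_smul, map_sum]
  congr 2
  refine Finset.sum_congr rfl fun i _ => ?_
  rw [map_smul, tangentProj_eq_self (v i).2, tangentProj,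
    ← Submodule.inner_starProjection_left_eq_right,
    Submodule.starProjection_eq_self_iff.2 (v i).2]

/-- At `x ∈ U_δ` the linear step `1 - s |Hess f(x)|` contracts `T_x M` by `1 - s μ`. On the
normal space `|Hess f(x)|` is replaced by `μ`, so that the bound holds on all of `ℝ^d`. -/
theorem norm_linearStep_le {c : Fin m → EuclideanSpace ℝ (Fin d) → ℝ}
    {f : EuclideanSpace ℝ (Fin d) → ℝ} (hf : ContDiff ℝ ∞ f)
    (hc : ∀ i, ContDiff ℝ ∞ (c i)) (hLICQ : LICQ c) {xs : EuclideanSpace ℝ (Fin d)}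
    {δ L μ : ℝ} (hkm : k + m < d) (hH : StrictSaddle c f k xs δ L μ)
    {x : EuclideanSpace ℝ (Fin d)} (hx : x ∈ geodesicBall c xs δ)
    {v : Fin k → tangentSpace c x} (hv : IsExactUnstable c f x v) {s : ℝ} (hs : 0 < s)
    (hsL : s ≤ 1 / L) (w : EuclideanSpace ℝ (Fin d)) :
    ‖w - s • (householderOp (fun i => (v i : EuclideanSpace ℝ (Fin d)))
      (tangentProj c x (fderiv ℝ (gradField c f) x (tangentProj c x w))) +
        μ • (w - tangentProj c x w))‖ ≤ (1 - s * μ) * ‖w‖ := by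
  obtain ⟨-, hμ, hμL, hspec⟩ := hH
  obtain ⟨ev, hev, hbd⟩ := hspec x hx
  obtain ⟨hvo, ev', hev', hHv⟩ := hv
  have hL : 0 < L := hμ.trans hμL
  have hsL' : s * L ≤ 1 := (le_div_iff₀ hL).1 hsL
  have hsμ : s * μ ≤ 1 := (mul_le_mul_of_nonneg_left hμL.le hs.le).trans hsL'
  have hee : ev' = ev := eq_of_monotone_of_prod_X_sub_C_eq hev'.1 hev.1 (hev'.2.symm.trans hev.2)
  subst hee
  have hsym := riemHess_isSymmetric hf hc hLICQ hx.1
  obtain ⟨r, hr⟩ : ∃ r, d - m = k + r := ⟨d - m - k, by omega⟩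
  have htan : ∀ u : tangentSpace c x,
      ‖u - s • (riemHess c f x u - (2 : ℝ) • ∑ i, ⟪v i, riemHess c f x u⟫ • v i)‖ ≤
        (1 - s * μ) * ‖u‖ := by
    have hch := hev.2
    clear hev hev'
    revert ev'
    rw [hr]
    intro ev hHv hbd hch u
    exact norm_sub_smul_reflect_le (T := tangentSpace c x) hsym ev hch hvo
      (fun i => hHv i (Fin.castAdd r i) rfl)
      (fun i => (hbd _).1 i.2) (fun i => (hbd _).2 (by simp)) hs.le hsL' hsμ u
  set u : tangentSpace c x := ⟨tangentProj c x w, tangentProj_apply_mem c x w⟩ with hu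
  set a : tangentSpace c x :=
    u - s • (riemHess c f x u - (2 : ℝ) • ∑ i, ⟪v i, riemHess c f x u⟫ • v i) with ha
  have hn : w - tangentProj c x w ∈ (tangentSpace c x)ᗮ :=
    Submodule.sub_starProjection_mem_orthogonal w
  have hcoe : (a : EuclideanSpace ℝ (Fin d)) =
      tangentProj c x w - s • householderOp (fun i => (v i : EuclideanSpace ℝ (Fin d)))
        (tangentProj c x (fderiv ℝ (gradField c f) x (tangentProj c x w))) := by
    have := coe_householder v (riemHess c f x u)
    rw [householder] at this
    rw [ha, Submodule.coe_sub, Submodule.coe_smul, this]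
    rfl
  have hsplit : w - s • (householderOp (fun i => (v i : EuclideanSpace ℝ (Fin d)))
      (tangentProj c x (fderiv ℝ (gradField c f) x (tangentProj c x w))) +
        μ • (w - tangentProj c x w)) =
      (a : EuclideanSpace ℝ (Fin d)) + (1 - s * μ) • (w - tangentProj c x w) := by
    rw [hcoe]; module
  have hpyth := norm_add_sq_eq_norm_sq_add_norm_sq_real
    ((Submodule.mem_orthogonal _ _).1 (Submodule.smul_mem _ (1 - s * μ) hn) a a.2)
  have hpyth' := norm_add_sq_eq_norm_sq_add_norm_sq_real
    ((Submodule.mem_orthogonal _ _).1 hn u u.2)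
  have huw : (u : EuclideanSpace ℝ (Fin d)) + (w - tangentProj c x w) = w := by simp [hu]
  rw [huw] at hpyth'
  have h1 : ‖(a : EuclideanSpace ℝ (Fin d))‖ ≤
      (1 - s * μ) * ‖(u : EuclideanSpace ℝ (Fin d))‖ := htan u
  have h0 : 0 ≤ 1 - s * μ := by linarith
  rw [hsplit]
  refine abs_le_of_sq_le_sq' ?_ (mul_nonneg h0 (norm_nonneg _)) |>.2
  rw [sq, hpyth, norm_smul, Real.norm_of_nonneg h0]
  have h2 := mul_self_le_mul_self (norm_nonneg _) h1
  calc _ ≤ (1 - s * μ) * ‖(u : EuclideanSpace ℝ (Fin d))‖ *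
          ((1 - s * μ) * ‖(u : EuclideanSpace ℝ (Fin d))‖) +
        (1 - s * μ) * ‖w - tangentProj c x w‖ * ((1 - s * μ) * ‖w - tangentProj c x w‖) := by
        gcongr
    _ = (1 - s * μ) ^ 2 * (‖w‖ * ‖w‖) := by rw [hpyth']; ring
    _ = _ := by ring

/-! ### First-order behaviour of the retraction -/

/-- A local extension `F` of the retraction satisfies `D₁F(y, 0) = D₂F(y, 0) = 1` on `T_y M`. -/
theorem fderiv_retraction_extension {c : Fin m → EuclideanSpace ℝ (Fin d) → ℝ}
    {Ret : (x : EuclideanSpace ℝ (Fin d)) → tangentSpace c x → EuclideanSpace ℝ (Fin d)}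
    (hRet : IsRetraction c Ret)
    {W : Set (EuclideanSpace ℝ (Fin d) × EuclideanSpace ℝ (Fin d))}
    {F : EuclideanSpace ℝ (Fin d) × EuclideanSpace ℝ (Fin d) → EuclideanSpace ℝ (Fin d)}
    (hW : IsOpen W)
    (hF : ∀ y ∈ feasibleSet c, ∀ w : tangentSpace c y,
      (y, (w : EuclideanSpace ℝ (Fin d))) ∈ W → Ret y w = F (y, (w : EuclideanSpace ℝ (Fin d))))
    {y : EuclideanSpace ℝ (Fin d)} (hy : y ∈ feasibleSet c) (hyW : (y, 0) ∈ W)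
    (hd : DifferentiableAt ℝ F (y, 0)) {w : EuclideanSpace ℝ (Fin d)}
    (hw : w ∈ tangentSpace c y) :
    fderiv ℝ F (y, 0) (w, 0) = w ∧ fderiv ℝ F (y, 0) (0, w) = w := by
  set w' : tangentSpace c y := ⟨w, hw⟩ with hw'
  set γ : ℝ → EuclideanSpace ℝ (Fin d) := fun t => Ret y (t • w') with hγ
  have hγ0 : γ 0 = y := by simp [hγ, hRet.zero y hy]
  have hγd : HasDerivAt γ w 0 := hRet.hasDerivAt y hy w'
  constructor
  · -- `F (·, 0)` fixes the curve `t ↦ Ret y (t w)`, whose velocity is `w`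
    have h1 : HasDerivAt (fun t => (γ t, (0 : EuclideanSpace ℝ (Fin d)))) (w, 0) 0 :=
      hγd.prodMk (hasDerivAt_const 0 0)
    have hd' : HasFDerivAt F (fderiv ℝ F (y, 0)) (γ 0, 0) := by rw [hγ0]; exact hd.hasFDerivAt
    have h2 := hd'.comp_hasDerivAt (0 : ℝ) h1
    have h3 : ∀ᶠ t in 𝓝 (0 : ℝ), (γ t, (0 : EuclideanSpace ℝ (Fin d))) ∈ W :=
      h1.continuousAt.eventually_mem (hW.mem_nhds (by rw [hγ0]; exact hyW))
    refine h2.unique (hγd.congr_of_eventuallyEq ?_)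
    filter_upwards [h3] with t ht
    have hm := hRet.mapsTo y hy (t • w')
    exact (hF (γ t) hm 0 ht).symm.trans (hRet.zero _ hm)
  · have h1 : HasDerivAt (fun t : ℝ => (y, t • w)) (0, w) 0 := by
      refine (hasDerivAt_const 0 y).prodMk ?_
      simpa using (hasDerivAt_id (0 : ℝ)).smul_const w
    have hd' : HasFDerivAt F (fderiv ℝ F (y, 0)) (y, (0 : ℝ) • w) := by
      rw [zero_smul]; exact hd.hasFDerivAt
    have h2 := hd'.comp_hasDerivAt (0 : ℝ) h1
    have h3 : ∀ᶠ t in 𝓝 (0 : ℝ), (y, t • w) ∈ W :=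
      h1.continuousAt.eventually_mem (hW.mem_nhds (by rw [zero_smul]; exact hyW))
    refine h2.unique (hγd.congr_of_eventuallyEq ?_)
    filter_upwards [h3] with t ht
    exact (hF y hy (t • w') ht).symm

/-! ### The derivative of one step -/

/-- First-order expansion of a step. Here `D`, `D'`, `D₀` stand for the derivatives of the
extended retraction at `(y, η)`, `(y, 0)` and `(xs, 0)`; `Py`, `Px`, `P₀` for the tangent
projections at `y`, `x`, `xs`; `Ay`, `Ax` for the derivatives of the Riemannian gradient, and `z`
for the derivative along `w` of the search direction `P R grad f`. The error carries a factor `s`,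
which makes the final estimate uniform in the step size. -/
theorem norm_stepDerivative_sub_le {E : Type*} [NormedAddCommGroup E] [NormedSpace ℝ E]
    {D D' D₀ : E × E →L[ℝ] E} {Py Px P₀ R Ay Ax : E →L[ℝ] E} {P' : E →L[ℝ] E →L[ℝ] E} {g w : E}
    {K ε s μ : ℝ} (hK : 1 ≤ K) (hε : 0 ≤ ε) (hs : 0 ≤ s) (hμ : 0 ≤ μ)
    (hDD' : ‖D - D'‖ ≤ K * (s * ε)) (hDD₀ : ‖D - D₀‖ ≤ ε) (hD : ‖D‖ ≤ K) (hD₀ : ‖D₀‖ ≤ K)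
    (hD₀P : ∀ u, D₀ (0, P₀ u) = P₀ u) (hPy : ‖Py - P₀‖ ≤ ε) (hPx : ‖Px - P₀‖ ≤ ε)
    (hPy1 : ∀ u, ‖Py u‖ ≤ ‖u‖) (hPx1 : ∀ u, ‖Px u‖ ≤ ‖u‖) (hR : ∀ u, ‖R u‖ = ‖u‖)
    (hRP : ∀ u, R (Px u) = Px (R u)) (hAy : ‖Ay‖ ≤ K) (hAx : ‖Ax‖ ≤ K) (hA : ‖Ay - Ax‖ ≤ ε)
    (hP' : ‖P'‖ ≤ K) (hg : ‖g‖ ≤ ε) (hD'w : D' (w, 0) = w) (hPw : Py w = w) :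
    ‖D (w, -(s • (P' w (R g) + Py (R (Ay w))))) -
      (w - s • (R (Px (Ax (Px w))) + μ • (w - Px w)))‖ ≤
      s * (ε * ((5 * K + 2 * K ^ 2 + 1 + 2 * μ) * ‖w‖)) := by
  have hK0 : 0 ≤ K := by linarith
  set u := R (Ay w) with hu
  have hun : ‖u‖ ≤ K * ‖w‖ := by
    rw [hu, hR]; exact Ay.le_of_opNorm_le hAy w
  have hPP : ‖Py - Px‖ ≤ 2 * ε := by
    calc ‖Py - Px‖ = ‖(Py - P₀) - (Px - P₀)‖ := by congr 1; abel
      _ ≤ ‖Py - P₀‖ + ‖Px - P₀‖ := norm_sub_le _ _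
      _ ≤ 2 * ε := by linarith
  have hwP : ‖w - Px w‖ ≤ 2 * ε * ‖w‖ := by
    have := (Py - Px).le_of_opNorm_le hPP w
    rwa [sub_apply, hPw] at this
  have hin1 : ∀ a : E, ‖((a, 0) : E × E)‖ = ‖a‖ := fun a => by simp [Prod.norm_def]
  have hin2 : ∀ a : E, ‖((0, a) : E × E)‖ = ‖a‖ := fun a => by simp [Prod.norm_def]
  have e1 : ‖(D - D') (w, 0)‖ ≤ s * (ε * (K * ‖w‖)) := by
    have := (D - D').le_of_opNorm_le hDD' (w, 0)
    rw [hin1] at this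
    linarith
  have e2 : ‖D (0, P' w (R g))‖ ≤ ε * (K * K * ‖w‖) := by
    calc ‖D (0, P' w (R g))‖ ≤ K * ‖P' w (R g)‖ := by
          simpa only [hin2] using D.le_of_opNorm_le hD (0, P' w (R g))
      _ ≤ K * (K * ‖w‖ * ε) := by
          gcongr
          refine ((P' w).le_opNorm _).trans ?_
          rw [hR]
          gcongr
          exact P'.le_of_opNorm_le hP' w
      _ = _ := by ring
  have e3 : ‖(D - D₀) (0, Py u)‖ ≤ ε * (K * ‖w‖) := by
    refine ((D - D₀).le_of_opNorm_le hDD₀ _).trans ?_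
    rw [hin2]
    gcongr
    exact (hPy1 u).trans hun
  have e4 : ‖D₀ (0, (Py - P₀) u)‖ ≤ ε * (K * K * ‖w‖) := by
    calc ‖D₀ (0, (Py - P₀) u)‖ ≤ K * ‖(Py - P₀) u‖ := by
          simpa only [hin2] using D₀.le_of_opNorm_le hD₀ (0, (Py - P₀) u)
      _ ≤ K * (ε * (K * ‖w‖)) := by
          gcongr
          exact ((Py - P₀).le_of_opNorm_le hPy u).trans (by gcongr)
      _ = _ := by ring
  have e5 : ‖(Px - P₀) u‖ ≤ ε * (K * ‖w‖) :=
    ((Px - P₀).le_of_opNorm_le hPx u).trans (by gcongr)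
  have e6 : ‖Px (R ((Ay - Ax) w))‖ ≤ ε * ‖w‖ := by
    refine (hPx1 _).trans ?_
    rw [hR]
    exact (Ay - Ax).le_of_opNorm_le hA w
  have e7 : ‖Px (R (Ax (w - Px w)))‖ ≤ ε * (2 * K * ‖w‖) := by
    refine (hPx1 _).trans ?_
    rw [hR]
    calc ‖Ax (w - Px w)‖ ≤ K * ‖w - Px w‖ := Ax.le_of_opNorm_le hAx _
      _ ≤ K * (2 * ε * ‖w‖) := by gcongr
      _ = _ := by ring
  have e8 : ‖μ • (w - Px w)‖ ≤ ε * (2 * μ * ‖w‖) := by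
    rw [norm_smul, Real.norm_of_nonneg hμ]
    calc μ * ‖w - Px w‖ ≤ μ * (2 * ε * ‖w‖) := by gcongr
      _ = _ := by ring
  have hdecomp : D (w, -(s • (P' w (R g) + Py u))) -
      (w - s • (R (Px (Ax (Px w))) + μ • (w - Px w))) =
      (D - D') (w, 0) - s • (D (0, P' w (R g)) + (D - D₀) (0, Py u) + D₀ (0, (Py - P₀) u)
        - (Px - P₀) u + Px (R ((Ay - Ax) w)) + Px (R (Ax (w - Px w))) - μ • (w - Px w)) := by
    have h1 : ((w, -(s • (P' w (R g) + Py u))) : E × E) =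
        (w, 0) - s • ((0, P' w (R g)) + (0, Py u)) := by
      ext <;> simp
    have h2 : ((0, (Py - P₀) u) : E × E) = (0, Py u) - (0, P₀ u) := by
      ext <;> simp
    rw [h1, h2]
    simp only [map_sub, map_add, map_smul, sub_apply, hD'w, hD₀P, hRP, ← hu]
    module
  rw [hdecomp]
  calc _ ≤ ‖(D - D') (w, 0)‖ + s * (‖D (0, P' w (R g))‖ + ‖(D - D₀) (0, Py u)‖ +
        ‖D₀ (0, (Py - P₀) u)‖ + ‖(Px - P₀) u‖ + ‖Px (R ((Ay - Ax) w))‖ +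
        ‖Px (R (Ax (w - Px w)))‖ + ‖μ • (w - Px w)‖) := by
        refine (norm_sub_le _ _).trans ?_
        rw [norm_smul, Real.norm_of_nonneg hs]
        gcongr
        refine (norm_sub_le _ _).trans ?_
        gcongr
        refine (norm_add_le _ _).trans ?_
        gcongr
        refine (norm_add_le _ _).trans ?_
        gcongr
        refine (norm_sub_le _ _).trans ?_
        gcongr
        exact norm_add₃_le
    _ ≤ s * (ε * (K * ‖w‖)) + s * (ε * (K * K * ‖w‖) + ε * (K * ‖w‖) + ε * (K * K * ‖w‖) +
        ε * (K * ‖w‖) + ε * ‖w‖ + ε * (2 * K * ‖w‖) + ε * (2 * μ * ‖w‖)) := by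
        gcongr
    _ = _ := by ring

/-! ### A contraction of `M` that realizes one step -/

set_option maxHeartbeats 800000 in
/-- Every step from `x` near `xs` is the value at `x` of a `C¹` map `Ψ` that fixes `xs`, preserves
`M` and shrinks tangent vectors by `1 - s μ / 2`, on a ball independent of `x` and `s`. Only the
reflection is frozen at `x`: `Ψ(y)` is the retraction of `-s P(y) R(x) grad f(y)`. -/
theorem exists_contraction {c : Fin m → EuclideanSpace ℝ (Fin d) → ℝ}
    {f : EuclideanSpace ℝ (Fin d) → ℝ} (hf : ContDiff ℝ ∞ f)
    (hc : ∀ i, ContDiff ℝ ∞ (c i)) (hLICQ : LICQ c)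
    {Ret : (x : EuclideanSpace ℝ (Fin d)) → tangentSpace c x → EuclideanSpace ℝ (Fin d)}
    (hRet : IsRetraction c Ret) {xs : EuclideanSpace ℝ (Fin d)} (hxs : IsIndexSaddle c f k xs)
    {δ L μ : ℝ} (hH : StrictSaddle c f k xs δ L μ) :
    ∃ ρ > 0, ∀ s : ℝ, 0 < s → s ≤ 1 / L → ∀ x ∈ geodesicBall c xs δ, x ∈ Metric.ball xs ρ →
      ∀ v : Fin k → tangentSpace c x, IsExactUnstable c f x v →
        ∃ Ψ : EuclideanSpace ℝ (Fin d) → EuclideanSpace ℝ (Fin d),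
          Ψ xs = xs ∧ Ψ x = Ret x (-s • householder v (riemGrad c f x)) ∧
          ∀ y ∈ feasibleSet c, y ∈ Metric.ball xs ρ →
            ContDiffAt ℝ 1 Ψ y ∧ Ψ y ∈ feasibleSet c ∧
            ∀ w ∈ tangentSpace c y, ‖fderiv ℝ Ψ y w‖ ≤ (1 - s * μ / 2) * ‖w‖ := by
  obtain ⟨hxsM, hcrit, hkm, -⟩ := hxs
  have hμ : 0 < μ := hH.2.1
  have hL : 0 < L := hμ.trans hH.2.2.1
  obtain ⟨W, F, hWo, hxsW, hFW, hFRet⟩ := hRet.smooth xs hxsM 0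
  replace hxsW : (xs, (0 : EuclideanSpace ℝ (Fin d))) ∈ W := hxsW
  have h2le : (2 : WithTop ℕ∞) ≤ (∞ : WithTop ℕ∞) := by
    simpa using WithTop.coe_le_coe.2 (le_top : (2 : ℕ∞) ≤ ⊤)
  have hF2 : ContDiffAt ℝ 2 F (xs, 0) :=
    (hFW.contDiffAt (hWo.mem_nhds hxsW)).of_le h2le
  have hP2 : ContDiffAt ℝ 2 (tangentProj c) xs :=
    (contDiffAt_tangentProj hc hLICQ hxsM).of_le h2le
  have hg2 : ContDiffAt ℝ 2 (gradField c f) xs :=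
    (contDiffAt_gradField hf hc hLICQ hxsM).of_le h2le
  have hDF : ContDiffAt ℝ 1 (fderiv ℝ F) (xs, 0) := hF2.fderiv_right (by norm_num)
  have hDP := (hP2.fderiv_right (m := 1) (by norm_num)).continuousAt.norm
  have hDg : ContinuousAt (fderiv ℝ (gradField c f)) xs :=
    (hg2.fderiv_right (m := 1) (by norm_num)).continuousAt
  have hg0 : gradField c f xs = 0 := by rw [gradField, hcrit]; rfl
  obtain ⟨Kl, N, hN, hLip⟩ := hDF.exists_lipschitzOnWith
  set K : ℝ := 1 + Kl + ‖fderiv ℝ F (xs, 0)‖ + ‖fderiv ℝ (tangentProj c) xs‖ +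
    ‖fderiv ℝ (gradField c f) xs‖ with hK
  have hKl : (0 : ℝ) ≤ Kl := Kl.2
  have n1 := norm_nonneg (fderiv ℝ F (xs, 0))
  have n2 := norm_nonneg (fderiv ℝ (tangentProj c) xs)
  have n3 := norm_nonneg (fderiv ℝ (gradField c f) xs)
  have hK1 : 1 ≤ K := by linarith
  set C : ℝ := 5 * K + 2 * K ^ 2 + 1 + 2 * μ with hC
  have hCpos : 0 < C := by positivity
  -- small enough that the error of the first-order expansion is at most `s * (μ / 2) * ‖w‖`
  set ε : ℝ := min (μ / (2 * C)) 1 with hε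
  have hεpos : 0 < ε := by positivity
  have hεC : ε * C ≤ μ / 2 := by
    calc ε * C ≤ μ / (2 * C) * C := by gcongr; exact min_le_left _ _
      _ = μ / 2 := by field_simp
  have hε1 : ε ≤ 1 := min_le_right _ _
  have hevF : ∀ᶠ p in 𝓝 (xs, (0 : EuclideanSpace ℝ (Fin d))), p ∈ W ∧ p ∈ N ∧
      ContDiffAt ℝ 2 F p ∧ dist (fderiv ℝ F p) (fderiv ℝ F (xs, 0)) < ε :=
    (hWo.eventually_mem hxsW).and (Filter.Eventually.and hN ((hF2.eventually (by simp)).and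
      (hDF.continuousAt.eventually_mem (Metric.ball_mem_nhds _ hεpos))))
  obtain ⟨ρF, hρF, hballF⟩ := Metric.eventually_nhds_iff_ball.1 hevF
  have hεg : 0 < min ε (ρF * L) := by positivity
  have hDPn : ∀ᶠ y in 𝓝 xs,
      ‖fderiv ℝ (tangentProj c) y‖ < ‖fderiv ℝ (tangentProj c) xs‖ + 1 :=
    hDP.eventually_lt_const (lt_add_one _)
  have hev : ∀ᶠ y in 𝓝 xs, ContDiffAt ℝ 2 (tangentProj c) y ∧ ContDiffAt ℝ 2 (gradField c f) y ∧
      ‖fderiv ℝ (tangentProj c) y‖ < ‖fderiv ℝ (tangentProj c) xs‖ + 1 ∧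
      dist (fderiv ℝ (gradField c f) y) (fderiv ℝ (gradField c f) xs) < ε / 2 ∧
      dist (tangentProj c y) (tangentProj c xs) < ε ∧
      dist (gradField c f y) (gradField c f xs) < min ε (ρF * L) :=
    (hP2.eventually (by simp)).and ((hg2.eventually (by simp)).and
      (hDPn.and
      ((hDg.eventually_mem (Metric.ball_mem_nhds _ (half_pos hεpos))).and
      ((hP2.continuousAt.eventually_mem (Metric.ball_mem_nhds _ hεpos)).and
      (hg2.continuousAt.eventually_mem (Metric.ball_mem_nhds _ hεg))))))
  obtain ⟨ρ₀, hρ₀, hball⟩ := Metric.eventually_nhds_iff_ball.1 hev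
  refine ⟨min ρ₀ ρF, lt_min hρ₀ hρF, fun s hs hsL x hx hxρ v hv => ?_⟩
  replace hball : ∀ y ∈ Metric.ball xs (min ρ₀ ρF), _ := fun y hy =>
    hball y (Metric.ball_subset_ball (min_le_left _ _) hy)
  have hnear : ∀ y ∈ Metric.ball xs (min ρ₀ ρF), ∀ η : EuclideanSpace ℝ (Fin d), ‖η‖ < ρF →
      (y, η) ∈ Metric.ball (xs, (0 : EuclideanSpace ℝ (Fin d))) ρF := by
    intro y hy η hη
    rw [Metric.mem_ball, Prod.dist_eq, max_lt_iff, dist_zero_right]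
    exact ⟨(Metric.mem_ball.1 hy).trans_le (min_le_right _ _), hη⟩
  set R := householderOp (fun i => (v i : EuclideanSpace ℝ (Fin d))) with hRdef
  have hvo : Orthonormal ℝ (fun i => (v i : EuclideanSpace ℝ (Fin d))) :=
    hv.1.comp_linearIsometry (tangentSpace c x).subtypeₗᵢ
  have hRn : ∀ u, ‖R u‖ = ‖u‖ := norm_householderOp_apply hvo
  set Z : EuclideanSpace ℝ (Fin d) → EuclideanSpace ℝ (Fin d) :=
    fun y => tangentProj c y (R (gradField c f y)) with hZ
  have hgn : ∀ y ∈ Metric.ball xs (min ρ₀ ρF), ‖gradField c f y‖ < min ε (ρF * L) := by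
    intro y hy
    have := (hball y hy).2.2.2.2.2
    rwa [hg0, dist_zero_right] at this
  have hZn : ∀ y, ‖Z y‖ ≤ ‖gradField c f y‖ := fun y =>
    (norm_tangentProj_apply_le c y _).trans (hRn _).le
  -- `s ≤ 1 / L` keeps the search direction in the domain of the extension `F`
  have hη : ∀ y ∈ Metric.ball xs (min ρ₀ ρF), ‖-(s • Z y)‖ < ρF := by
    intro y hy
    rw [norm_neg, norm_smul, Real.norm_of_nonneg hs.le]
    calc s * ‖Z y‖ ≤ 1 / L * ‖gradField c f y‖ := by gcongr; exact hZn y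
      _ < 1 / L * (ρF * L) := by
        gcongr
        exact (hgn y hy).trans_le (min_le_right _ _)
      _ = ρF := by field_simp
  have hZmem : ∀ y, -(s • Z y) ∈ tangentSpace c y := fun y =>
    Submodule.neg_mem _ (Submodule.smul_mem _ _ (tangentProj_apply_mem c y _))
  have hval : ∀ y ∈ feasibleSet c, y ∈ Metric.ball xs (min ρ₀ ρF) →
      F (y, -(s • Z y)) = Ret y ⟨-(s • Z y), hZmem y⟩ := fun y hyM hy =>
    (hFRet y hyM ⟨_, hZmem y⟩ (hballF _ (hnear y hy _ (hη y hy))).1).symm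
  have hxsball : xs ∈ Metric.ball xs (min ρ₀ ρF) := Metric.mem_ball_self (lt_min hρ₀ hρF)
  refine ⟨fun y => F (y, -(s • Z y)), ?_, ?_, fun y hyM hy => ?_⟩
  · beta_reduce
    rw [hval xs hxsM hxsball]
    have : (⟨-(s • Z xs), hZmem xs⟩ : tangentSpace c xs) = 0 := by
      ext1
      simp [hZ, hg0]
    rw [this, hRet.zero xs hxsM]
  · beta_reduce
    rw [hval x hx.1 hxρ]
    congr 1
    ext1
    rw [Submodule.coe_smul, coe_householder, neg_smul]
    simp only [hZ, ← householderOp_tangentProj_comm, R]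
    rw [tangentProj_eq_self (riemGrad c f x).2 (x := x) (w := gradField c f x)]
    rfl
  · obtain ⟨hPy, hgy, hPy', hgy', hPyd, -⟩ := hball y hy
    obtain ⟨-, -, -, hgx', hPxd, -⟩ := hball x hxρ
    obtain ⟨-, hpN, hFp, hFpd⟩ := hballF _ (hnear y hy _ (hη y hy))
    obtain ⟨hy0W, hy0N, hF0, -⟩ := hballF _ (hnear y hy 0 (by simpa using hρF))
    have hZc : ContDiffAt ℝ 2 Z y := hPy.clm_apply (R.contDiff.contDiffAt.comp y hgy)
    have harg : ContDiffAt ℝ 2 (fun y => (y, -(s • Z y))) y :=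
      contDiffAt_id.prodMk (hZc.const_smul s).neg
    refine ⟨(hFp.comp y harg).of_le (by norm_num), ?_, fun w hw => ?_⟩
    · beta_reduce
      rw [hval y hyM hy]
      exact hRet.mapsTo y hyM _
    have hPyD := (hPy.differentiableAt (by norm_num)).hasFDerivAt
    have hgyD := (hgy.differentiableAt (by norm_num)).hasFDerivAt
    have hZD := hPyD.clm_apply (R.hasFDerivAt.comp y hgyD)
    have hΨD := (hFp.differentiableAt (by norm_num)).hasFDerivAt.comp y
      ((hasFDerivAt_id y).prodMk (hZD.const_smul s).neg)
    have hder : fderiv ℝ (fun y => F (y, -(s • Z y))) y w = fderiv ℝ F (y, -(s • Z y))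
        (w, -(s • (fderiv ℝ (tangentProj c) y w (R (gradField c f y)) +
          tangentProj c y (R (fderiv ℝ (gradField c f) y w))))) := by
      have := congrArg (fun A => A w) hΨD.fderiv
      refine Eq.trans this ?_
      simp [add_comm]
    rw [dist_eq_norm] at hgy' hPyd hgx' hPxd hFpd
    have hgε : ‖gradField c f y‖ ≤ ε := ((hgn y hy).trans_le (min_le_left _ _)).le
    have hAy : ‖fderiv ℝ (gradField c f) y‖ ≤ K := by
      have := norm_le_insert' (fderiv ℝ (gradField c f) y) (fderiv ℝ (gradField c f) xs)
      linarith
    have hAx : ‖fderiv ℝ (gradField c f) x‖ ≤ K := by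
      have := norm_le_insert' (fderiv ℝ (gradField c f) x) (fderiv ℝ (gradField c f) xs)
      linarith
    have hAA : ‖fderiv ℝ (gradField c f) y - fderiv ℝ (gradField c f) x‖ ≤ ε := by
      rw [← sub_sub_sub_cancel_right _ _ (fderiv ℝ (gradField c f) xs)]
      exact (norm_sub_le _ _).trans (by linarith)
    have hDK : ‖fderiv ℝ F (y, -(s • Z y))‖ ≤ K := by
      have := norm_le_insert' (fderiv ℝ F (y, -(s • Z y))) (fderiv ℝ F (xs, 0))
      linarith
    have hPK : ‖fderiv ℝ (tangentProj c) y‖ ≤ K := by linarith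
    have hlip := hLip.norm_sub_le hpN hy0N
    have hDD' : ‖fderiv ℝ F (y, -(s • Z y)) - fderiv ℝ F (y, 0)‖ ≤ K * (s * ε) := by
      refine hlip.trans ?_
      have : ‖(y, -(s • Z y)) - (y, (0 : EuclideanSpace ℝ (Fin d)))‖ ≤ s * ε := by
        simp only [Prod.mk_sub_mk, sub_self, sub_zero, Prod.norm_def, norm_zero, norm_neg,
          norm_smul, Real.norm_of_nonneg hs.le]
        refine max_le (by positivity) ?_
        gcongr
        exact (hZn y).trans hgε
      gcongr
      linarith
    have hstep := norm_stepDerivative_sub_le (D := fderiv ℝ F (y, -(s • Z y)))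
      (D' := fderiv ℝ F (y, 0)) (D₀ := fderiv ℝ F (xs, 0)) (Py := tangentProj c y)
      (Px := tangentProj c x) (P₀ := tangentProj c xs) (R := R)
      (Ay := fderiv ℝ (gradField c f) y) (Ax := fderiv ℝ (gradField c f) x)
      (P' := fderiv ℝ (tangentProj c) y) (g := gradField c f y) (w := w) hK1 hεpos.le hs.le hμ.le
      hDD'
      hFpd.le hDK (by linarith)
      (fun u => (fderiv_retraction_extension hRet hWo hFRet hxsM hxsW
        (hF2.differentiableAt (by norm_num)) (tangentProj_apply_mem c xs u)).2)
      hPyd.le hPxd.le (norm_tangentProj_apply_le c y) (norm_tangentProj_apply_le c x) hRn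
      (householderOp_tangentProj_comm v) hAy hAx hAA hPK
      hgε
      (fderiv_retraction_extension hRet hWo hFRet hyM hy0W
        (hF0.differentiableAt (by norm_num)) hw).1
      (tangentProj_eq_self hw)
    have hlin := norm_linearStep_le hf hc hLICQ hkm hH hx hv hs hsL w
    rw [hder]
    refine (norm_le_insert' _ _).trans ((add_le_add hlin hstep).trans ?_)
    have : s * (ε * (C * ‖w‖)) ≤ s * (μ / 2 * ‖w‖) := by
      rw [← mul_assoc ε]; gcongr
    linarith

/-- One step contracts the geodesic distance to `xs`: the map `Ψ` sends short curves from `x` to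
`xs` to shorter ones from the next iterate to `xs`. -/
theorem exists_radius_geodesicEDist_step_le {c : Fin m → EuclideanSpace ℝ (Fin d) → ℝ}
    {f : EuclideanSpace ℝ (Fin d) → ℝ} (hf : ContDiff ℝ ∞ f)
    (hc : ∀ i, ContDiff ℝ ∞ (c i)) (hLICQ : LICQ c)
    {Ret : (x : EuclideanSpace ℝ (Fin d)) → tangentSpace c x → EuclideanSpace ℝ (Fin d)}
    (hRet : IsRetraction c Ret) {xs : EuclideanSpace ℝ (Fin d)} (hxs : IsIndexSaddle c f k xs)
    {δ L μ : ℝ} (hH : StrictSaddle c f k xs δ L μ) :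
    ∃ r > 0, r ≤ δ ∧ ∀ s : ℝ, 0 < s → s ≤ 1 / L → ∀ x ∈ geodesicBall c xs r,
      ∀ v : Fin k → tangentSpace c x, IsExactUnstable c f x v →
        geodesicEDist c (Ret x (-s • householder v (riemGrad c f x))) xs ≤
          ENNReal.ofReal (1 - s * μ / 2) * geodesicEDist c x xs := by
  obtain ⟨ρ, hρ, hstep⟩ := exists_contraction hf hc hLICQ hRet hxs hH
  refine ⟨min δ ρ, lt_min hH.1 hρ, min_le_left _ _, fun s hs hsL x hx v hv => ?_⟩
  have hxδ : x ∈ geodesicBall c xs δ :=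
    ⟨hx.1, hx.2.trans_le (ENNReal.ofReal_le_ofReal (min_le_left _ _))⟩
  have hxd : geodesicEDist c x xs < ENNReal.ofReal ρ :=
    hx.2.trans_le (ENNReal.ofReal_le_ofReal (min_le_right _ _))
  have hball : ∀ y, edist y xs < ENNReal.ofReal ρ → y ∈ Metric.ball xs ρ := fun y hy => by
    rwa [edist_dist, ENNReal.ofReal_lt_ofReal_iff hρ] at hy
  obtain ⟨Ψ, hΨxs, hΨx, hΨ⟩ :=
    hstep s hs hsL x hxδ (hball x (edist_le_geodesicEDist.trans_lt hxd)) v hv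
  rw [← hΨx]
  -- curves of length at least `ρ` leave the ball, but play no role in the infimum
  refine ENNReal.le_of_forall_pos_le_add fun a ha _ => ?_
  have hlt : geodesicEDist c x xs < min (ENNReal.ofReal ρ) (geodesicEDist c x xs + a) :=
    lt_min hxd (ENNReal.lt_add_right hxd.ne_top (by exact_mod_cast ha.ne'))
  obtain ⟨γ, hγ, hγl⟩ := exists_curveLength_lt hlt
  have hq : ENNReal.ofReal (1 - s * μ / 2) ≤ 1 := by
    rw [ENNReal.ofReal_le_one]
    have := mul_pos hs hH.2.1
    linarith
  obtain ⟨hcurve, hlen⟩ := hγ.comp hc (Ψ := Ψ) (q := 1 - s * μ / 2) fun t ht =>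
    hΨ (γ t) (hγ.2.1 t ht)
      (hball _ ((edist_le_curveLength hγ ht).trans_lt (hγl.trans_le (min_le_left _ _))))
  rw [hΨxs] at hcurve
  calc geodesicEDist c (Ψ x) xs ≤ curveLength (Ψ ∘ γ) := geodesicEDist_le_curveLength hcurve
    _ ≤ ENNReal.ofReal (1 - s * μ / 2) * curveLength γ := hlen
    _ ≤ ENNReal.ofReal (1 - s * μ / 2) * (geodesicEDist c x xs + a) := by
        gcongr
        exact (hγl.trans_le (min_le_right _ _)).le
    _ ≤ ENNReal.ofReal (1 - s * μ / 2) * geodesicEDist c x xs + a := by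
        rw [mul_add]
        gcongr
        exact mul_le_of_le_one_left' hq

end CSD

theorem mainTheorem2 {d m k : ℕ}
    (f : EuclideanSpace ℝ (Fin d) → ℝ) (c : Fin m → EuclideanSpace ℝ (Fin d) → ℝ)
    (hf : ContDiff ℝ ∞ f) (hc : ∀ i, ContDiff ℝ ∞ (c i)) (hLICQ : CSD.LICQ c)
    (Ret : (x : EuclideanSpace ℝ (Fin d)) → CSD.tangentSpace c x → EuclideanSpace ℝ (Fin d))
    (hRet : CSD.IsRetraction c Ret)
    (xs : EuclideanSpace ℝ (Fin d)) (hxs : CSD.IsIndexSaddle c f k xs)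
    (δ L μ : ℝ) (hH : CSD.StrictSaddle c f k xs δ L μ) :
    ∃ U ∈ 𝓝[CSD.feasibleSet c] xs, ∀ Δt : ℝ, 0 < Δt → Δt ≤ 1 / L →
      (∀ (x : ℕ → EuclideanSpace ℝ (Fin d)) (v : (n : ℕ) → Fin k → CSD.tangentSpace c (x n)),
        CSD.IsDiscreteCSD c f Ret Δt x v → x 0 ∈ U →
          (∀ n, x n ∈ CSD.geodesicBall c xs δ) ∧
          Tendsto x atTop (𝓝 xs) ∧
          ∀ n, CSD.geodesicEDist c (x (n + 1)) xs ≤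
            ENNReal.ofReal (1 - Δt * μ / 2) * CSD.geodesicEDist c (x n) xs) ∧
      1 - 1 / (2 * (L / μ)) ≤ 1 - Δt * μ / 2 ∧ 1 - Δt * μ / 2 < 1 ∧
      (Δt = 1 / L → 1 - Δt * μ / 2 = 1 - 1 / (2 * (L / μ))) := by
  obtain ⟨r, hr, hrδ, hstep⟩ :=
    CSD.exists_radius_geodesicEDist_step_le hf hc hLICQ hRet hxs hH
  refine ⟨CSD.geodesicBall c xs r, CSD.geodesicBall_mem_nhdsWithin hc hLICQ hxs.1 hr,
    fun s hs hsL => ?_⟩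
  have hμ : 0 < μ := hH.2.1
  have hL : 0 < L := hμ.trans hH.2.2.1
  have hrate : 1 / L * μ / 2 = 1 / (2 * (L / μ)) := by field_simp
  refine ⟨fun x v hx hx0 => ?_, ?_, ?_, ?_⟩
  · set q : ℝ≥0∞ := ENNReal.ofReal (1 - s * μ / 2) with hqdef
    have hq : q < 1 := by
      rw [hqdef, ENNReal.ofReal_lt_one]
      have := mul_pos hs hμ
      linarith
    have hnext : ∀ n, x n ∈ CSD.geodesicBall c xs r →
        CSD.geodesicEDist c (x (n + 1)) xs ≤ q * CSD.geodesicEDist c (x n) xs := by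
      intro n hn
      rw [hx.step n]
      exact hstep s hs hsL (x n) hn (v n) (hx.exact_eigenvectors n)
    have hmem : ∀ n, x n ∈ CSD.geodesicBall c xs r := by
      intro n
      induction n with
      | zero => exact hx0
      | succ n ih =>
        refine ⟨?_, (hnext n ih).trans_lt ((mul_le_of_le_one_left' hq.le).trans_lt ih.2)⟩
        rw [hx.step n]
        exact hRet.mapsTo _ ih.1 _
    have hgeom : ∀ n, CSD.geodesicEDist c (x n) xs ≤ q ^ n * CSD.geodesicEDist c (x 0) xs := by
      intro n
      induction n with
      | zero => simp
      | succ n ih =>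
        calc _ ≤ q * CSD.geodesicEDist c (x n) xs := hnext n (hmem n)
          _ ≤ q * (q ^ n * CSD.geodesicEDist c (x 0) xs) := by gcongr
          _ = _ := by ring
    refine ⟨fun n => ⟨(hmem n).1, (hmem n).2.trans_le (ENNReal.ofReal_le_ofReal hrδ)⟩, ?_,
      fun n => hnext n (hmem n)⟩
    rw [tendsto_iff_edist_tendsto_0]
    have hlim : Tendsto (fun n => q ^ n * CSD.geodesicEDist c (x 0) xs) atTop (𝓝 0) := by
      have := ENNReal.Tendsto.mul_const (b := CSD.geodesicEDist c (x 0) xs)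
        (ENNReal.tendsto_pow_atTop_nhds_zero_of_lt_one hq) (Or.inr hx0.2.ne_top)
      simpa using this
    exact tendsto_of_tendsto_of_tendsto_of_le_of_le tendsto_const_nhds hlim (fun _ => zero_le)
      fun n => CSD.edist_le_geodesicEDist.trans (hgeom n)
  · have : s * μ ≤ 1 / L * μ := mul_le_mul_of_nonneg_right hsL hμ.le
    linarith
  · have := mul_pos hs hμ
    linarith
  · rintro rfl
    rw [hrate]
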